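/- Notation: $n\sim N$ means $N<n\le 2N$; $\psi_M(x):=\psi(x/M)$; $\tau$ is the divisor function, $\varphi$ Euler's function, and $\varrho(d)$ is the number of residue classes $\nu \bmod d$ with $\nu^2+1\equiv 0 \pmod d$. All inequalities $\prec\!\!\prec$ are modulo logarithmic factors: $F\prec\!\!\prec G$ means $|F|\le C\,G\,\log^{B}(3+M+L+D)$ for some constants $B,C$. A function $\alpha:\mathbb N\to\mathbb C$ is divisor bounded if $|\alpha(d)|\le A\,\tau(d)^K\log^K(d+2)$ for all $d\ge 1$, for some constants $A,K$. Proposition 3. Let $k\ge 1$ be an integer, let $\psi:\mathbb R\to\mathbb C$ be a fixed $C^\infty$-smooth compactly supported function and let $\varepsilon>0$. Let $M,L,D\gg 1$ (that is, they are at least some fixed constant $c>0$), let $\lambda_\ell$ be complex coefficients with $|\lambda_\ell|\le 1$ if $\ell=n^k$ for some integer $n$ and $\lambda_\ell=0$ otherwise, let $\alpha$ be divisor bounded, and let $m_0$ be a real number with $m_0\prec\!\!\prec M$. Then $$\sum_{d\sim D}\alpha(d)\Bigg(\sum_{\substack{\ell\sim L,\ m\in\mathbb Z\\ (\ell,m)=1\\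 \ell^2+m^2\equiv 0\,(d)}}\lambda_\ell\,\psi_M(m-m_0)-\int_{\mathbb R}\psi_M(t)\,dt\;\frac{\varrho(d)}{d}\sum_{\substack{\ell\sim L\\(\ell,d)=1}}\lambda_\ell\frac{\varphi(\ell)}{\ell}\Bigg)\prec\!\!\prec_{\varepsilon} M^{\varepsilon}(L+M)^{1/2}D^{1/2}L^{1/(2k)},$$ where the constants depend only on $k$, $\psi$, $\varepsilon$ and the constants implied in the hypotheses $M,L,D\gg1$, $m_0\prec\!\!\prec M$ and the divisor boundedness of $\alpha$. In particular (Type I information for $a^2+b^{2k}$ up to the level $x^{1/2+1/(2k)-\varepsilon}$), if moreover $x\ge 1$, $M,L\ll x^{1/2}$ and $D\le x^{1/2+1/(2k)-\varepsilon}$, then the left-hand side is $\ll x^{1/2+1/(2k)-\varepsilon/4}$, with the same dependence of the constant (and on the constant implied in $M,L\ll x^{1/2}$). -/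

import Mathlib

open scoped ContDiff

noncomputable section

namespace TypeI

/-- The positive integers `n` with `n ∼ N`, that is `N < n ≤ 2 N` (for real `N ≥ 0`). -/
def dyadic (N : ℝ) : Finset ℕ := Finset.Ioc ⌊N⌋₊ ⌊2 * N⌋₊

theorem mem_dyadic {N : ℝ} (hN : 0 ≤ N) (n : ℕ) :
    n ∈ dyadic N ↔ N < n ∧ (n : ℝ) ≤ 2 * N := by
  rw [dyadic, Finset.mem_Ioc, Nat.floor_lt hN, Nat.le_floor_iff (by positivity)]

/-- `ϱ(d)`, the number of residue classes `ν` modulo `d` with `ν² + 1 ≡ 0 (mod d)`. -/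
def rho (d : ℕ) : ℕ := ((Finset.range d).filter (fun ν => d ∣ ν ^ 2 + 1)).card

/-- The dilation `ψ_M(x) = ψ(x / M)`. -/
def dilate (ψ : ℝ → ℂ) (M : ℝ) (x : ℝ) : ℂ := ψ (x / M)

/-- `|f(d)| ≤ A τ(d)^K log^K (d + 2)` for all `d ≥ 1`: `f` is divisor bounded precisely when this
holds for some `A` and `K`. -/
def DivisorBoundedBy (A : ℝ) (K : ℕ) (f : ℕ → ℂ) : Prop :=
  ∀ d : ℕ, 1 ≤ d →
    ‖f d‖ ≤ A * (d.divisors.card : ℝ) ^ K * Real.log ((d : ℝ) + 2) ^ K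

/-- `|a_ℓ| ≤ 1` if `ℓ` is a `k`-th power of an integer, and `a_ℓ = 0` otherwise. -/
def SupportedOnPowers (k : ℕ) (a : ℕ → ℂ) : Prop :=
  ∀ ℓ : ℕ, ‖a ℓ‖ ≤ Set.indicator {j : ℕ | ∃ n : ℕ, j = n ^ k} (fun _ => (1 : ℝ)) ℓ

/-- The logarithmic factor, at least `1`, modulo powers of which inequalities are understood. -/
def logFactor (M L D : ℝ) : ℝ := Real.log (3 + M + L + D)

/-- The sum of `a_ℓ ψ_M(m - m₀)` over integers `ℓ ∼ L` and all integers `m` with `(ℓ, m) = 1`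
and `ℓ² + m² ≡ 0 (mod d)`. (For compactly supported `ψ` and `M > 0`, only finitely many `m`
contribute.) -/
def congruenceSum (ψ : ℝ → ℂ) (M L m₀ : ℝ) (a : ℕ → ℂ) (d : ℕ) : ℂ :=
  ∑ ℓ ∈ dyadic L, ∑' m : ℤ,
    if Int.gcd (ℓ : ℤ) m = 1 ∧ (d : ℤ) ∣ (ℓ : ℤ) ^ 2 + m ^ 2 then
      a ℓ * dilate ψ M ((m : ℝ) - m₀)
    else 0

/-- The expected main term
`∫ ψ_M(t) dt · (ϱ(d) / d) · ∑_{ℓ ∼ L, (ℓ, d) = 1} a_ℓ φ(ℓ) / ℓ`. -/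
def expectedTerm (ψ : ℝ → ℂ) (M L : ℝ) (a : ℕ → ℂ) (d : ℕ) : ℂ :=
  (∫ t : ℝ, dilate ψ M t) * ((rho d : ℂ) / (d : ℂ)) *
    ∑ ℓ ∈ (dyadic L).filter (fun ℓ => Nat.Coprime ℓ d),
      a ℓ * ((Nat.totient ℓ : ℂ) / (ℓ : ℂ))

/-- The Type I sum over `d ∼ D` with weights `α(d)`, minus its expected main term. -/
def typeIError (ψ : ℝ → ℂ) (M L D m₀ : ℝ) (a α : ℕ → ℂ) : ℂ :=
  ∑ d ∈ dyadic D, α d * (congruenceSum ψ M L m₀ a d - expectedTerm ψ M L a d)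

end TypeI

end

noncomputable section
namespace TypeI

open Finset

/-! For coprime ℓ, m the condition d ∣ ℓ² + m² says that m ≡ νℓ (mod d) for exactly one root ν of ν²
+ 1 ≡ 0 (mod d). Möbius inversion over b ∣ ℓ removes the coprimality, and since b ∣ ℓ the two
congruences merge into m ≡ νℓ modulo lcm(b, d). Poisson summation in m then gives frequencies h: the
term h = 0 is exactly the expected term, and h ≠ 0 carries the phase e(hνℓ/lcm(b, d)) =
e(h(ℓ/b)·ν/q) with g = gcd(b, d), q = d/g. Frequencies beyond bD/(gM) are damped by the smoothness
of ψ.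

What remains is bounded by Cauchy–Schwarz and a large sieve over the fractions ν/q. These are far
better spaced than general fractions with denominators of size D/g: the norm of q'(ν + i) − q(ν' +
i) is a positive multiple of qq' (`root_spacing`), so the spacing is ≫ g/D when q and q' are close.
For |h| ≍ H the sieve (`large_sieve_roots`) costs g(D/g + HL/b). The coefficients of n = h(ℓ/b) have
second moment about H·L^(1/k)/b, because n has few factorizations and a squarefree b dividing n^k
divides n (`sum_powersDyadic_le`). Together with ∑ |α(d)|²ϱ(d) ≪ D/g this bounds each triple (b, g,
H) by √(D(M + L)L^(1/k))/b, up to divisor and logarithmic factors (`block_bound`), and summing over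
b costs only logarithms.

Two technical points remain. The Fourier weights depend on d; opening the Fourier integral separates
d from h (`exists_norm_blockSum_le`). The Poisson sum is cut at a large power of 3 + M + L + D, so
there are logarithmically many dyadic blocks of h and the tail is bounded. Only logarithms are lost
(`typeIError_bound`), and the factor M^ε enters at the very end. -/

/-! ### Moments of the divisor function. -/

theorem card_divisors_mul_le (m n : ℕ) :
    (m * n).divisors.card ≤ m.divisors.card * n.divisors.card := by
  rw [Nat.divisors_mul]
  exact Finset.card_mul_le

theorem card_divisors_pow_le (n k : ℕ) : (n ^ k).divisors.card ≤ n.divisors.card ^ k := by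
  induction k with
  | zero => simp
  | succ k ih =>
    rw [pow_succ, pow_succ]
    exact (card_divisors_mul_le _ _).trans (Nat.mul_le_mul_right _ ih)

/-- Writing τ(n) as the number of factorizations n = pq and using submultiplicativity, the sum
becomes part of the double sum that is the square on the right. -/
theorem sum_card_divisors_mul_le {N : ℕ} {F : ℕ → ℝ} (hF : ∀ n, 0 ≤ F n)
    (hmul : ∀ m n, F (m * n) ≤ F m * F n) :
    ∑ n ∈ Icc 1 N, (n.divisors.card : ℝ) * F n ≤ (∑ n ∈ Icc 1 N, F n) ^ 2 := by
  have h1 : ∀ n ∈ Icc 1 N, (n.divisors.card : ℝ) * F n ≤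
      ∑ p ∈ ((Icc 1 N ×ˢ Icc 1 N).filter (fun p => p.1 * p.2 ∈ Icc 1 N)).filter
        (fun p => p.1 * p.2 = n), F p.1 * F p.2 := by
    intro n hn
    rw [mem_Icc] at hn
    have h2 : n.divisorsAntidiagonal ⊆
        ((Icc 1 N ×ˢ Icc 1 N).filter (fun p => p.1 * p.2 ∈ Icc 1 N)).filter
        (fun p => p.1 * p.2 = n) := by
      intro p hp
      rw [Nat.mem_divisorsAntidiagonal] at hp
      have hp1 : p.1 ≠ 0 := by rintro h; apply hp.2; rw [← hp.1, h, zero_mul]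
      have hp2 : p.2 ≠ 0 := by rintro h; apply hp.2; rw [← hp.1, h, mul_zero]
      have h3 : p.1 ≤ n := Nat.le_of_dvd (by omega) ⟨p.2, hp.1.symm⟩
      have h4 : p.2 ≤ n := Nat.le_of_dvd (by omega) ⟨p.1, by rw [mul_comm]; exact hp.1.symm⟩
      simp only [mem_filter, mem_product, mem_Icc, hp.1]
      refine ⟨⟨⟨⟨?_, ?_⟩, ?_, ?_⟩, ?_, ?_⟩, trivial⟩ <;> omega
    calc (n.divisors.card : ℝ) * F n = ∑ p ∈ n.divisorsAntidiagonal, F (p.1 * p.2) := by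
          rw [sum_congr rfl (g := fun _ => F n), sum_const, nsmul_eq_mul,
            ← Nat.map_div_right_divisors, card_map]
          intro p hp
          rw [(Nat.mem_divisorsAntidiagonal.mp hp).1]
      _ ≤ ∑ p ∈ n.divisorsAntidiagonal, F p.1 * F p.2 := sum_le_sum fun p _ => hmul _ _
      _ ≤ _ := sum_le_sum_of_subset_of_nonneg h2 fun p _ _ => mul_nonneg (hF _) (hF _)
  refine (sum_le_sum h1).trans ?_
  rw [sum_fiberwise_of_maps_to (fun p hp => (mem_filter.mp hp).2), sq, sum_mul_sum,
    ← sum_product']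
  exact sum_le_sum_of_subset_of_nonneg (filter_subset _ _)
    fun p _ _ => mul_nonneg (hF _) (hF _)

/-- Each induction step peels off one factor τ at the price of squaring the bound, hence the
exponent 2^j; the base case is the harmonic sum. -/
theorem sum_card_divisors_pow_div_le (j N : ℕ) :
    ∑ n ∈ Icc 1 N, (n.divisors.card : ℝ) ^ j / n ≤ (1 + Real.log N) ^ (2 ^ j) := by
  induction j with
  | zero =>
    have := harmonic_le_one_add_log N
    rw [harmonic_eq_sum_Icc] at this
    push_cast at this
    simpa using this
  | succ j ih =>
    have h := sum_card_divisors_mul_le (N := N) (F := fun n => (n.divisors.card : ℝ) ^ j / n)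
      (fun n => by positivity) (fun m n => by
        rw [div_mul_div_comm, ← mul_pow]
        push_cast
        gcongr
        exact_mod_cast card_divisors_mul_le m n)
    calc _ = ∑ n ∈ Icc 1 N, (n.divisors.card : ℝ) * ((n.divisors.card : ℝ) ^ j / n) :=
          sum_congr rfl fun n _ => by rw [pow_succ]; ring
      _ ≤ _ := h
      _ ≤ ((1 + Real.log N) ^ (2 ^ j)) ^ 2 := by
          gcongr
      _ = _ := by rw [← pow_mul, pow_succ 2 j]

theorem sum_card_divisors_pow_le (j N : ℕ) :
    ∑ n ∈ Icc 1 N, (n.divisors.card : ℝ) ^ j ≤ N * (1 + Real.log N) ^ (2 ^ j) := by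
  refine le_trans ?_ (mul_le_mul_of_nonneg_left (sum_card_divisors_pow_div_le j N)
    (Nat.cast_nonneg N))
  rw [mul_sum]
  refine sum_le_sum fun n hn => ?_
  rw [mem_Icc] at hn
  have hn0 : (0 : ℝ) < n := by exact_mod_cast hn.1
  have hnN : (n : ℝ) ≤ N := by exact_mod_cast hn.2
  rw [← mul_div_assoc, le_div_iff₀ hn0, mul_comm]
  gcongr

/-! ### Roots of ν² + 1 modulo d. -/

/-- The residues `ν` modulo `d` with `ν² + 1 ≡ 0 (mod d)`. -/
def rootsNegOne (d : ℕ) : Finset ℕ := (range d).filter (fun ν => d ∣ ν ^ 2 + 1)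

theorem mem_rootsNegOne {d ν : ℕ} : ν ∈ rootsNegOne d ↔ ν < d ∧ d ∣ ν ^ 2 + 1 := by
  simp [rootsNegOne]

theorem card_rootsNegOne (d : ℕ) : (rootsNegOne d).card = rho d := rfl

/-- A root z splits d = ef with e = gcd(z − a, d) dividing z − a and f dividing z + a. Two roots
with the same e agree modulo e and modulo f. Since 2a = (x + a) − (x − a) is a combination of f and
e, the product ef divides 2a(x − y), and a is a unit modulo d. -/
theorem dvd_two_mul_sub_of_gcd_eq {d : ℕ} {a x y : ℤ} (ha : (d : ℤ) ∣ a ^ 2 + 1)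
    (hx : (d : ℤ) ∣ x ^ 2 + 1) (hy : (d : ℤ) ∣ y ^ 2 + 1) (hd : d ≠ 0)
    (h : Int.gcd (x - a) d = Int.gcd (y - a) d) : (d : ℤ) ∣ 2 * (x - y) := by
  have key : ∀ z : ℤ, (d : ℤ) ∣ z ^ 2 + 1 → ∃ f : ℤ, (d : ℤ) = Int.gcd (z - a) d * f ∧
      f ∣ z + a ∧ ((Int.gcd (z - a) d : ℕ) : ℤ) ∣ z - a := by
    intro z hz
    have he : ((Int.gcd (z - a) d : ℕ) : ℤ) ∣ (d : ℤ) := Int.gcd_dvd_right _ _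
    obtain ⟨f, hf⟩ := he
    refine ⟨f, hf, ?_, Int.gcd_dvd_left _ _⟩
    have hpos : 0 < Int.gcd (z - a) d := Int.gcd_pos_of_ne_zero_right _ (by exact_mod_cast hd)
    have hmul : (d : ℤ) ∣ (z - a) * (z + a) := by
      have : (z - a) * (z + a) = (z ^ 2 + 1) - (a ^ 2 + 1) := by ring
      rw [this]; exact dvd_sub hz ha
    obtain ⟨u, hu⟩ : ((Int.gcd (z - a) d : ℕ) : ℤ) ∣ z - a := Int.gcd_dvd_left _ _
    have hne : ((Int.gcd (z - a) d : ℕ) : ℤ) ≠ 0 := by exact_mod_cast hpos.ne'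
    have hcop : IsCoprime f u := by
      have h1 := Int.gcd_eq_gcd_ab (z - a) d
      refine ⟨Int.gcdB (z - a) d, Int.gcdA (z - a) d, ?_⟩
      apply mul_left_cancel₀ hne
      calc _ = (Int.gcd (z - a) d * u) * Int.gcdA (z - a) d
            + (Int.gcd (z - a) d * f) * Int.gcdB (z - a) d := by ring
        _ = _ := by rw [← hu, ← hf, ← h1, mul_one]
    refine hcop.dvd_of_dvd_mul_left ?_
    apply Int.dvd_of_mul_dvd_mul_left hne
    rw [← hf, ← mul_assoc, ← hu]
    exact hmul
  obtain ⟨f, hf, hfx, hex⟩ := key x hx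
  obtain ⟨f', hf', hfy, hey⟩ := key y hy
  rw [← h] at hf' hey
  set e : ℤ := ((Int.gcd (x - a) d : ℕ) : ℤ) with he
  have hne : e ≠ 0 := by
    rintro h0
    rw [h0, zero_mul] at hf
    exact hd (by exact_mod_cast hf)
  have hff : f = f' := mul_left_cancel₀ hne (hf.symm.trans hf')
  subst hff
  have h1 : e ∣ x - y := by
    have := dvd_sub hex hey
    simpa using this
  have h2 : f ∣ x - y := by
    have := dvd_sub hfx hfy
    simpa using this
  -- `gcd e f` divides `2 a` and is coprime to `a`
  have h3 : e * f ∣ (2 * a) * (x - y) := by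
    obtain ⟨u, hu⟩ := h1
    obtain ⟨v, hv⟩ := h2
    obtain ⟨p, hp⟩ := hfx
    obtain ⟨q, hq⟩ := hex
    refine ⟨p * u - q * v, ?_⟩
    have : 2 * a = f * p - e * q := by rw [← hp, ← hq]; ring
    rw [this, sub_mul]
    nth_rewrite 1 [hu]
    rw [hv]; ring
  rw [← hf] at h3
  have hc : IsCoprime (d : ℤ) a := by
    obtain ⟨t, ht⟩ := ha
    exact ⟨t, -a, by linear_combination (-1 : ℤ) * ht⟩
  have h4 : (d : ℤ) ∣ a * (2 * (x - y)) := by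
    have : a * (2 * (x - y)) = (2 * a) * (x - y) := by ring
    rw [this]; exact h3
  exact hc.dvd_of_dvd_mul_left h4

/-- Relative to a fixed root a, the roots are sorted by the divisor gcd(ν − a, d) of d. Within a
class 2(x − y)/d is an integer of absolute value less than 2, which leaves three values. -/
theorem card_rootsNegOne_le (d : ℕ) : (rootsNegOne d).card ≤ 3 * d.divisors.card := by
  rcases (rootsNegOne d).eq_empty_or_nonempty with h | ⟨a, ha⟩
  · simp [h]
  rw [mem_rootsNegOne] at ha
  have hd : d ≠ 0 := by omega
  have hd0 : (0 : ℤ) < d := by omega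
  have hcast : ∀ {x : ℕ}, d ∣ x ^ 2 + 1 → (d : ℤ) ∣ (x : ℤ) ^ 2 + 1 := by
    intro x hx; exact_mod_cast Int.natCast_dvd_natCast.mpr hx
  refine card_le_mul_card_image_of_maps_to (f := fun ν : ℕ => Int.gcd ((ν : ℤ) - a) d)
    (fun ν _ => ?_) 3 ?_
  · rw [Nat.mem_divisors]
    exact ⟨by exact_mod_cast Int.gcd_dvd_right ((ν : ℤ) - a) (d : ℤ), hd⟩
  · intro e _
    rcases ((rootsNegOne d).filter
      (fun ν : ℕ => Int.gcd ((ν : ℤ) - a) d = e)).eq_empty_or_nonempty with h | ⟨y, hy⟩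
    · rw [h]; simp
    have hy' := mem_filter.mp hy
    rw [mem_rootsNegOne] at hy'
    have hdvd : ∀ x ∈ (rootsNegOne d).filter (fun ν : ℕ => Int.gcd ((ν : ℤ) - a) d = e),
        x < d ∧ (d : ℤ) ∣ 2 * ((x : ℤ) - y) := by
      intro x hx
      have hx' := mem_filter.mp hx
      rw [mem_rootsNegOne] at hx'
      exact ⟨hx'.1.1, dvd_two_mul_sub_of_gcd_eq (hcast ha.2) (hcast hx'.1.2) (hcast hy'.1.2) hd
        (hx'.2.trans hy'.2.symm)⟩
    have hcard : (Icc (-1 : ℤ) 1).card = 3 := by simp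
    rw [← hcard]
    refine card_le_card_of_injOn (fun x : ℕ => 2 * ((x : ℤ) - y) / d) ?_ ?_
    · intro x hx
      obtain ⟨hx1, c, hc⟩ := hdvd x hx
      simp only [hc, Int.mul_ediv_cancel_left _ hd0.ne']
      have hy1 := hy'.1.1
      rw [coe_Icc, Set.mem_Icc]
      constructor
      · by_contra hlt
        have : c ≤ -2 := by omega
        have : (d : ℤ) * c ≤ d * (-2) := mul_le_mul_of_nonneg_left this hd0.le
        omega
      · by_contra hlt
        have : 2 ≤ c := by omega
        have : (d : ℤ) * 2 ≤ d * c := mul_le_mul_of_nonneg_left this hd0.le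
        omega
    · intro x hx z hz hxz
      obtain ⟨_, c, hc⟩ := hdvd x hx
      obtain ⟨_, c', hc'⟩ := hdvd z hz
      simp only [hc, hc', Int.mul_ediv_cancel_left _ hd0.ne'] at hxz
      rw [hxz] at hc
      omega

/-! ### Möbius sums. -/

open ArithmeticFunction in
theorem sum_moebius_filter_dvd {l : ℕ} (hl : l ≠ 0) (m : ℤ) :
    ∑ b ∈ l.divisors.filter (fun b : ℕ => (b : ℤ) ∣ m), moebius b =
      if Int.gcd (l : ℤ) m = 1 then 1 else 0 := by
  have h1 : l.divisors.filter (fun b : ℕ => (b : ℤ) ∣ m) = (Int.gcd (l : ℤ) m).divisors := by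
    ext b
    have hg : Int.gcd (l : ℤ) m ≠ 0 := by
      intro h; rw [Int.gcd_eq_zero_iff] at h; exact hl (by exact_mod_cast h.1)
    simp only [mem_filter, Nat.mem_divisors, hl, hg, ne_eq, not_false_eq_true, and_true]
    rw [Int.dvd_gcd_iff]
    simp [Int.natCast_dvd_natCast]
  rw [h1, ← coe_mul_zeta_apply, moebius_mul_coe_zeta, one_apply]

open ArithmeticFunction in
-- For b ∣ l, 1/lcm(b, d) is 1/(ld) times the number of m ≤ l with b ∣ dm. The Möbius sum over b
-- then counts the m for which l is coprime to dm.
theorem sum_moebius_div_lcm {l d : ℕ} (hl : l ≠ 0) (hd : d ≠ 0) :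
    ∑ b ∈ l.divisors, (moebius b : ℂ) / (Nat.lcm b d : ℂ) =
      if Nat.Coprime l d then (Nat.totient l : ℂ) / l / d else 0 := by
  have hl' : (l : ℂ) ≠ 0 := by exact_mod_cast hl
  have hd' : (d : ℂ) ≠ 0 := by exact_mod_cast hd
  have h1 : ∀ b ∈ l.divisors, (moebius b : ℂ) / (Nat.lcm b d : ℂ) =
      (∑ m ∈ Ioc 0 l, if b ∣ d * m then (moebius b : ℂ) else 0) / (l * d) := by
    intro b hb
    rw [Nat.mem_divisors] at hb
    have hb0 : b ≠ 0 := by rintro rfl; exact hl (Nat.eq_zero_of_zero_dvd hb.1)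
    rw [← sum_filter, sum_const, nsmul_eq_mul]
    obtain ⟨b', d', hbd, hb', hd''⟩ := Nat.exists_coprime b d
    obtain ⟨c, hc⟩ := hb.1
    have hg0 : Nat.gcd b d ≠ 0 := Nat.gcd_ne_zero_right hd
    have hb'0 : b' ≠ 0 := by
      rintro rfl
      exact hb0 (by rw [hb', zero_mul])
    have hd'0 : d' ≠ 0 := by
      rintro rfl
      exact hd (by rw [hd'', zero_mul])
    have hgl := Nat.gcd_mul_lcm b d
    generalize Nat.gcd b d = g at *
    have h2 : (Ioc 0 l).filter (fun m => b ∣ d * m) = (Ioc 0 l).filter (fun m => b' ∣ m) := by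
      apply filter_congr
      intro m _
      rw [hb', hd'', mul_right_comm]
      constructor
      · intro h
        exact hbd.dvd_of_dvd_mul_left (Nat.dvd_of_mul_dvd_mul_right (Nat.pos_of_ne_zero hg0) h)
      · rintro ⟨t, rfl⟩
        exact ⟨d' * t, by ring⟩
    have hlcm : Nat.lcm b d = b' * d := by
      apply Nat.eq_of_mul_eq_mul_left (Nat.pos_of_ne_zero hg0)
      rw [hgl]
      nth_rewrite 1 [hb']
      ring
    have hlb : l = b' * (g * c) := by
      rw [hc, hb']; ring
    have hlb' : l / b' = g * c :=
      Nat.div_eq_of_eq_mul_right (Nat.pos_of_ne_zero hb'0) hlb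
    have hc0 : c ≠ 0 := by
      rintro rfl
      exact hl (by rw [hc, mul_zero])
    have hlc : (l : ℂ) = b' * (g * c) := by exact_mod_cast hlb
    rw [h2, Nat.Ioc_filter_dvd_card_eq_div, hlb', hlcm, hlc]
    have hb'' : (b' : ℂ) ≠ 0 := by exact_mod_cast hb'0
    have hgc : (g : ℂ) ≠ 0 := by exact_mod_cast hg0
    have hcc : (c : ℂ) ≠ 0 := by exact_mod_cast hc0
    push_cast
    field_simp
  rw [sum_congr rfl h1, ← sum_div, sum_comm]
  have h3 : ∀ m ∈ Ioc 0 l, (∑ b ∈ l.divisors, if b ∣ d * m then (moebius b : ℂ) else 0) =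
      if Nat.Coprime l (d * m) then 1 else 0 := by
    intro m _
    rw [← sum_filter]
    have := sum_moebius_filter_dvd hl ((d * m : ℕ) : ℤ)
    simp only [Int.natCast_dvd_natCast, Int.gcd_natCast_natCast] at this
    rw [← Int.cast_sum, this]
    simp [Nat.Coprime]
  rw [sum_congr rfl h3]
  split_ifs with hcop
  · have h4 : ∀ m, Nat.Coprime l (d * m) ↔ Nat.Coprime l m := fun m => by
      rw [Nat.coprime_mul_iff_right]; exact and_iff_right hcop
    simp only [h4]
    rw [← sum_filter, sum_const, nsmul_eq_mul, mul_one,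
      ← Nat.filter_coprime_Ico_eq_totient l 1, div_div]
    congr 3
    ext m
    simp only [mem_filter, mem_Ioc, mem_Ico]
    refine and_congr_left fun _ => ?_
    omega
  · have h4 : ∀ m, ¬ Nat.Coprime l (d * m) := fun m h =>
      hcop (Nat.coprime_mul_iff_right.mp h).1
    simp [h4]

/-! ### Additive characters and the large sieve. -/

open MeasureTheory

/-- The additive character `e(x) = exp(2πix)`. -/
def ex (x : ℝ) : ℂ := Complex.exp (((2 * Real.pi * x : ℝ) : ℂ) * Complex.I)

theorem norm_ex (x : ℝ) : ‖ex x‖ = 1 := Complex.norm_exp_ofReal_mul_I _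

theorem ex_add (x y : ℝ) : ex (x + y) = ex x * ex y := by
  rw [ex, ex, ex, ← Complex.exp_add]; congr 1; push_cast; ring

theorem ex_zero : ex 0 = 1 := by simp [ex]

theorem ex_intCast (n : ℤ) : ex n = 1 := by
  rw [ex, Complex.exp_eq_one_iff]
  exact ⟨n, by push_cast; ring⟩

theorem continuous_ex : Continuous ex := by
  unfold ex; fun_prop

theorem conj_ex (x : ℝ) : (starRingEnd ℂ) (ex x) = ex (-x) := by
  rw [ex, ex, ← Complex.exp_conj]
  congr 1
  rw [map_mul, Complex.conj_I, Complex.conj_ofReal]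
  push_cast
  ring

theorem hasDerivAt_ex (c t : ℝ) :
    HasDerivAt (fun t : ℝ => ex (c * t)) (2 * Real.pi * Complex.I * c * ex (c * t)) t := by
  have h : HasDerivAt (fun t : ℝ => ((2 * Real.pi * (c * t) : ℝ) : ℂ) * Complex.I)
      (((2 * Real.pi * c : ℝ) : ℂ) * Complex.I) t := by
    refine HasDerivAt.mul_const ?_ _
    apply HasDerivAt.ofReal_comp
    have := ((hasDerivAt_id t).const_mul c).const_mul (2 * Real.pi)
    simpa using this
  have h2 := h.cexp
  unfold ex
  convert! h2 using 1
  push_cast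
  ring

theorem integral_ex_of_ne {n : ℤ} (hn : n ≠ 0) (u : ℝ) (G : ℕ) :
    ∫ t in u..(u + G), ex (n * t) = 0 := by
  have hc : (2 * Real.pi * Complex.I * (n : ℝ) : ℂ) ≠ 0 := by
    simp [Real.pi_ne_zero, hn]
  have h : ∀ t ∈ Set.uIcc u (u + G), HasDerivAt
      (fun t : ℝ => ex (n * t) / (2 * Real.pi * Complex.I * (n : ℝ))) (ex (n * t)) t := by
    intro t _
    have := (hasDerivAt_ex n t).div_const (2 * Real.pi * Complex.I * (n : ℝ))
    rwa [mul_div_cancel_left₀ _ hc] at this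
  rw [intervalIntegral.integral_eq_sub_of_hasDerivAt h]
  · have : ((n : ℝ) * (u + G)) = n * u + ((n * G : ℤ) : ℝ) := by push_cast; ring
    rw [this, ex_add, ex_intCast, mul_one, sub_self]
  · exact (continuous_ex.comp (by fun_prop)).intervalIntegrable _ _

/-- A trigonometric polynomial with frequencies in `S`. -/
def trigPoly (S : Finset ℤ) (a : ℤ → ℂ) (x : ℝ) : ℂ := ∑ n ∈ S, a n * ex (n * x)

theorem continuous_trigPoly (S : Finset ℤ) (a : ℤ → ℂ) : Continuous (trigPoly S a) := by
  unfold trigPoly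
  refine continuous_finsetSum _ fun n _ => ?_
  exact continuous_const.mul (continuous_ex.comp (by fun_prop))

theorem integral_norm_trigPoly_sq (S : Finset ℤ) (a : ℤ → ℂ) (u : ℝ) (G : ℕ) :
    ∫ t in u..(u + G), ‖trigPoly S a t‖ ^ 2 = G * ∑ n ∈ S, ‖a n‖ ^ 2 := by
  have h1 : ∀ t : ℝ, ((‖trigPoly S a t‖ ^ 2 : ℝ) : ℂ) =
      ∑ n ∈ S, ∑ m ∈ S, a n * (starRingEnd ℂ) (a m) * ex (((n - m : ℤ) : ℝ) * t) := by
    intro t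
    rw [Complex.ofReal_pow, ← Complex.mul_conj', trigPoly, map_sum, sum_mul_sum]
    refine sum_congr rfl fun n _ => sum_congr rfl fun m _ => ?_
    have : ((n - m : ℤ) : ℝ) * t = n * t + -(m * t) := by push_cast; ring
    rw [this, ex_add, map_mul, conj_ex]; ring
  have hcont : ∀ n m : ℤ, Continuous
      (fun t : ℝ => a n * (starRingEnd ℂ) (a m) * ex (((n - m : ℤ) : ℝ) * t)) :=
    fun n m => continuous_const.mul (continuous_ex.comp (by fun_prop))
  have hint : ∀ n m : ℤ, IntervalIntegrable
      (fun t : ℝ => a n * (starRingEnd ℂ) (a m) * ex (((n - m : ℤ) : ℝ) * t)) volume u (u + G) :=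
    fun n m => (hcont n m).intervalIntegrable _ _
  have hint' : ∀ n : ℤ, IntervalIntegrable (fun t : ℝ => ∑ m ∈ S,
      a n * (starRingEnd ℂ) (a m) * ex (((n - m : ℤ) : ℝ) * t)) volume u (u + G) :=
    fun n => (continuous_finsetSum _ fun m _ => hcont n m).intervalIntegrable _ _
  have h2 : ((∫ t in u..(u + G), ‖trigPoly S a t‖ ^ 2 : ℝ) : ℂ) =
      ((G * ∑ n ∈ S, ‖a n‖ ^ 2 : ℝ) : ℂ) := by
    rw [← intervalIntegral.integral_ofReal]
    simp only [h1]
    rw [intervalIntegral.integral_finsetSum fun n _ => hint' n]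
    simp only [Complex.ofReal_mul, Complex.ofReal_natCast, Complex.ofReal_sum, Complex.ofReal_pow]
    rw [mul_sum]
    refine sum_congr rfl fun n hn => ?_
    rw [intervalIntegral.integral_finsetSum fun m _ => hint n m]
    rw [sum_eq_single n]
    · simp only [sub_self, Int.cast_zero, zero_mul, ex_zero, mul_one,
        intervalIntegral.integral_const, add_sub_cancel_left]
      rw [Complex.mul_conj']
      simp
    · intro m _ hmn
      rw [intervalIntegral.integral_const_mul, integral_ex_of_ne (sub_ne_zero.mpr hmn.symm),
        mul_zero]
    · exact fun h => absurd hn h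
  exact_mod_cast h2

/-- Cauchy–Schwarz, read off from the nonnegative variance of `f` about its mean. -/
theorem sq_integral_le {f : ℝ → ℝ} (hf : Continuous f) {u v : ℝ} (huv : u < v) :
    (∫ t in u..v, f t) ^ 2 ≤ (v - u) * ∫ t in u..v, f t ^ 2 := by
  set I := ∫ t in u..v, f t with hI
  have hpos : 0 < v - u := sub_pos.mpr huv
  have h0 : 0 ≤ ∫ t in u..v, (f t - I / (v - u)) ^ 2 :=
    intervalIntegral.integral_nonneg huv.le fun t _ => sq_nonneg _
  have h1 : ∫ t in u..v, (f t - I / (v - u)) ^ 2 =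
      (∫ t in u..v, f t ^ 2) - I ^ 2 / (v - u) := by
    have : ∀ t, (f t - I / (v - u)) ^ 2 =
        f t ^ 2 - (2 * (I / (v - u))) * f t + (I / (v - u)) ^ 2 := fun t => by ring
    simp only [this]
    rw [intervalIntegral.integral_add, intervalIntegral.integral_sub,
      intervalIntegral.integral_const_mul, ← hI, intervalIntegral.integral_const, smul_eq_mul]
    · field_simp; ring
    all_goals exact Continuous.intervalIntegrable (by fun_prop) _ _
  rw [h1] at h0
  have h2 : I ^ 2 / (v - u) ≤ ∫ t in u..v, f t ^ 2 := by linarith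
  rwa [div_le_iff₀' hpos] at h2

/-- The angle is at most π/4 < 1, so the cosine stays above 1/2 on an interval of length 2η. -/
theorem le_integral_cos {n : ℤ} {η : ℝ} (hη : 0 < η) (hn : |(n : ℝ)| * η ≤ 1 / 8) :
    η ≤ ∫ t in (-η)..η, Real.cos (2 * Real.pi * (n * t)) := by
  have h1 : ∫ _ in (-η)..η, (1 / 2 : ℝ) = η := by
    rw [intervalIntegral.integral_const]; simp; ring
  refine h1.symm.le.trans ?_
  have hc : Continuous fun t : ℝ => Real.cos (2 * Real.pi * (n * t)) := by fun_prop
  refine intervalIntegral.integral_mono_on (μ := volume) (by linarith) (by simp)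
    (hc.intervalIntegrable _ _) fun t ht => ?_
  have ht' : |t| ≤ η := abs_le.mpr ht
  have h2 := Real.one_sub_sq_div_two_le_cos (x := 2 * Real.pi * (n * t))
  have h3 : |2 * Real.pi * (n * t)| ≤ 1 := by
    rw [abs_mul, abs_of_pos Real.two_pi_pos, abs_mul]
    have h4 : |(n : ℝ)| * |t| ≤ 1 / 8 :=
      (mul_le_mul_of_nonneg_left ht' (abs_nonneg _)).trans hn
    have := Real.pi_lt_four
    calc 2 * Real.pi * (|(n : ℝ)| * |t|) ≤ 2 * Real.pi * (1 / 8) :=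
          mul_le_mul_of_nonneg_left h4 Real.two_pi_pos.le
      _ ≤ 1 := by linarith
  have h5 : (2 * Real.pi * (n * t)) ^ 2 ≤ 1 := by
    rw [← sq_abs]; exact pow_le_one₀ (abs_nonneg _) h3
  linarith

theorem integral_ex_symm (n : ℤ) (x η : ℝ) :
    ∫ t in (x - η)..(x + η), ex (n * t) =
      ex (n * x) * ((∫ t in (-η)..η, Real.cos (2 * Real.pi * (n * t)) : ℝ) : ℂ) := by
  have h1 : ∫ t in (x - η)..(x + η), ex (n * t) = ∫ t in (-η)..η, ex (n * (x + t)) := by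
    rw [intervalIntegral.integral_comp_add_left (fun t => ex (n * t)) x]
    rfl
  have h2 : ∀ t : ℝ, ex (n * (x + t)) = ex (n * x) * ex (n * t) := fun t => by
    rw [← ex_add]; congr 1; ring
  rw [h1]
  simp only [h2]
  rw [intervalIntegral.integral_const_mul]
  congr 1
  have h3 : ∫ t in (-η)..η, ex (n * t) = ∫ t in (-η)..η, ex (-(n * t)) := by
    have := intervalIntegral.integral_comp_neg (a := -η) (b := η) (fun t => ex (n * t))
    rw [neg_neg] at this
    rw [← this]
    congr 1
    ext t
    congr 1
    ring
  have h4 : ∀ t : ℝ, ((Real.cos (2 * Real.pi * (n * t)) : ℝ) : ℂ) =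
      (1 / 2) * (ex (n * t) + ex (-(n * t))) := by
    intro t
    rw [ex, ex, Complex.ofReal_cos, Complex.cos]
    push_cast
    ring_nf
  rw [← intervalIntegral.integral_ofReal]
  simp only [h4]
  rw [intervalIntegral.integral_const_mul, intervalIntegral.integral_add, ← h3]
  · ring
  · exact (continuous_ex.comp (by fun_prop)).intervalIntegrable _ _
  · exact (continuous_ex.comp (by fun_prop)).intervalIntegrable _ _

/-- The large sieve inequality, for points of `[0, G)` that are well spaced in `ℝ`. -/
theorem large_sieve {ι : Type*} (T : Finset ι) (x : ι → ℝ) (G : ℕ) (S : Finset ℤ) (a : ℤ → ℂ)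
    {η : ℝ} (hη : 0 < η) (hη' : η ≤ 1 / 2) (hS : ∀ n ∈ S, |(n : ℝ)| * η ≤ 1 / 8)
    (hx0 : ∀ i ∈ T, 0 ≤ x i) (hxG : ∀ i ∈ T, x i ≤ G)
    (hsep : ∀ i ∈ T, ∀ j ∈ T, i ≠ j → 2 * η ≤ |x i - x j|) :
    ∑ i ∈ T, ‖trigPoly S a (x i)‖ ^ 2 ≤ 2 * (G + 1) / η * ∑ n ∈ S, ‖a n‖ ^ 2 := by
  -- Integrating over [y − η, y + η] multiplies the n-th coefficient by `s n`, which is at least η.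
  -- Dividing it out in advance makes the value at y exactly a local integral, to which
  -- Cauchy–Schwarz applies.
  set s : ℤ → ℝ := fun n => ∫ t in (-η)..η, Real.cos (2 * Real.pi * (n * t)) with hs
  have hsη : ∀ n ∈ S, η ≤ s n := fun n hn => le_integral_cos hη (hS n hn)
  set b : ℤ → ℂ := fun n => a n / (s n : ℂ) with hb
  have h1 : ∀ y : ℝ, trigPoly S a y = ∫ t in (y - η)..(y + η), trigPoly S b t := by
    intro y
    unfold trigPoly
    rw [intervalIntegral.integral_finsetSum]
    · refine sum_congr rfl fun n hn => ?_
      rw [intervalIntegral.integral_const_mul, integral_ex_symm]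
      have : (s n : ℂ) ≠ 0 := by
        exact_mod_cast (hη.trans_le (hsη n hn)).ne'
      simp only [hb]
      change _ = a n / (s n : ℂ) * (_ * (s n : ℂ))
      field_simp
    · intro n _
      exact (continuous_const.mul (continuous_ex.comp (by fun_prop))).intervalIntegrable _ _
  have hcont := continuous_trigPoly S b
  have h2 : ∀ y : ℝ, ‖trigPoly S a y‖ ^ 2 ≤
      2 * η * ∫ t in Set.Ioc (y - η) (y + η), ‖trigPoly S b t‖ ^ 2 := by
    intro y
    have hlt : y - η < y + η := by linarith
    rw [h1, ← intervalIntegral.integral_of_le hlt.le]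
    calc _ ≤ (∫ t in (y - η)..(y + η), ‖trigPoly S b t‖) ^ 2 := by
          gcongr
          exact intervalIntegral.norm_integral_le_integral_norm hlt.le
      _ ≤ (y + η - (y - η)) * ∫ t in (y - η)..(y + η), ‖trigPoly S b t‖ ^ 2 :=
          sq_integral_le hcont.norm hlt
      _ = _ := by congr 1; ring
  have hdisj : Set.Pairwise (T : Set ι)
      (fun i j => Disjoint (Set.Ioc (x i - η) (x i + η)) (Set.Ioc (x j - η) (x j + η))) := by
    intro i hi j hj hij
    rw [Set.disjoint_left]
    rintro t ⟨ht1, ht2⟩ ⟨ht3, ht4⟩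
    have := hsep i hi j hj hij
    have h3 : |x i - x j| < 2 * η := by rw [abs_lt]; constructor <;> linarith
    linarith
  -- As η ≤ 1/2, the disjoint intervals all lie in a window of integer length G + 1, on which
  -- Parseval is exact.
  have h3 : ∑ i ∈ T, ∫ t in Set.Ioc (x i - η) (x i + η), ‖trigPoly S b t‖ ^ 2 ≤
      ∫ t in Set.Ioc (-1 / 2 : ℝ) (-1 / 2 + ((G + 1 : ℕ) : ℝ)), ‖trigPoly S b t‖ ^ 2 := by
    have hint : ∀ u v : ℝ, IntegrableOn (fun t => ‖trigPoly S b t‖ ^ 2) (Set.Ioc u v) :=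
      fun u v => ((hcont.norm.pow 2).integrableOn_Icc).mono_set Set.Ioc_subset_Icc_self
    rw [← integral_biUnion_finset T (fun i _ => measurableSet_Ioc) hdisj (fun i _ => hint _ _)]
    refine setIntegral_mono_set (hint _ _)
      (Filter.Eventually.of_forall fun t => sq_nonneg _)
      (LE.le.eventuallyLE ?_)
    refine Set.iUnion₂_subset fun i hi t ht => ?_
    have h4 := hx0 i hi
    have h5 := hxG i hi
    push_cast
    exact ⟨by linarith [ht.1], by linarith [ht.2]⟩
  rw [← intervalIntegral.integral_of_le (by push_cast; linarith [Nat.cast_nonneg (α := ℝ) G]),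
    integral_norm_trigPoly_sq] at h3
  have h6 : ∑ n ∈ S, ‖b n‖ ^ 2 ≤ (∑ n ∈ S, ‖a n‖ ^ 2) / η ^ 2 := by
    rw [sum_div]
    refine sum_le_sum fun n hn => ?_
    rw [hb]
    simp only
    rw [norm_div, Complex.norm_real, Real.norm_of_nonneg (hη.le.trans (hsη n hn)), div_pow]
    have := hsη n hn
    gcongr
  calc ∑ i ∈ T, ‖trigPoly S a (x i)‖ ^ 2
      ≤ ∑ i ∈ T, 2 * η * ∫ t in Set.Ioc (x i - η) (x i + η), ‖trigPoly S b t‖ ^ 2 :=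
        sum_le_sum fun i _ => h2 _
    _ ≤ 2 * η * (((G + 1 : ℕ) : ℝ) * ((∑ n ∈ S, ‖a n‖ ^ 2) / η ^ 2)) := by
        rw [← mul_sum]
        have : (((G + 1 : ℕ) : ℝ) * ∑ n ∈ S, ‖b n‖ ^ 2) ≤
          (((G + 1 : ℕ) : ℝ) * ((∑ n ∈ S, ‖a n‖ ^ 2) / η ^ 2)) := by gcongr
        exact mul_le_mul_of_nonneg_left (h3.trans this) (by linarith)
    _ = _ := by push_cast; field_simp

/-! ### Spacing of the fractions ν/q. -/

/-- The right side is the norm of the Gaussian integer q'(ν + i) − q(ν' + i). With ν² + 1 = qc and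
ν'² + 1 = q'c' it expands to a multiple of qq', and it is nonzero because the pairs differ. Nothing
requires ν < q, so roots modulo a multiple of q are allowed. -/
theorem root_spacing {q q' ν ν' : ℕ} (hq : 0 < q) (hq' : 0 < q') (h : q ∣ ν ^ 2 + 1)
    (h' : q' ∣ ν' ^ 2 + 1) (hne : (q, ν) ≠ (q', ν')) :
    (q : ℝ) * q' ≤ ((ν : ℝ) * q' - ν' * q) ^ 2 + ((q : ℝ) - q') ^ 2 := by
  obtain ⟨c, hc⟩ := h
  obtain ⟨c', hc'⟩ := h'
  have hcz : (ν : ℤ) ^ 2 + 1 = q * c := by exact_mod_cast hc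
  have hcz' : (ν' : ℤ) ^ 2 + 1 = q' * c' := by exact_mod_cast hc'
  have key : ((ν : ℤ) * q' - ν' * q) ^ 2 + ((q : ℤ) - q') ^ 2 =
      q * q' * (q * c' + q' * c - 2 * ν * ν' - 2) := by
    linear_combination ((q' : ℤ) ^ 2) * hcz + ((q : ℤ) ^ 2) * hcz'
  have hqq : (0 : ℤ) < q * q' := by positivity
  have hpos : (0 : ℤ) < (ν * q' - ν' * q) ^ 2 + ((q : ℤ) - q') ^ 2 := by
    rcases eq_or_ne q q' with heq | heq
    · have hν : ν ≠ ν' := fun hν => hne (by rw [heq, hν])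
      subst heq
      have : (ν : ℤ) * q - ν' * q ≠ 0 := by
        rw [← sub_mul]
        exact mul_ne_zero (by omega) (by omega)
      positivity
    · have : (q : ℤ) - q' ≠ 0 := by omega
      positivity
  rw [key] at hpos
  have h1 : (1 : ℤ) ≤ q * c' + q' * c - 2 * ν * ν' - 2 := (pos_iff_pos_of_mul_pos hpos).mp hqq
  have h2 : (q : ℤ) * q' ≤ (ν * q' - ν' * q) ^ 2 + ((q : ℤ) - q') ^ 2 := by
    rw [key]; nlinarith
  exact_mod_cast h2

/-- The large sieve inequality for the fractions `ν / q`, `q = d / g`, where `d ≍ D` and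
`ν² + 1 ≡ 0 (mod d)`. -/
theorem large_sieve_roots_short {D N : ℝ} {g : ℕ} (hD : 0 < D) (hN : 0 ≤ N) (T : Finset ℕ)
    (hT : ∀ d ∈ T, g ∣ d ∧ D * g < d ∧ (d : ℝ) ≤ 2 * D * g)
    (hT' : ∀ d ∈ T, ∀ d' ∈ T, |(d : ℝ) - d'| ≤ D * g / 2)
    (S : Finset ℤ) (a : ℤ → ℂ) (hS : ∀ n ∈ S, |(n : ℝ)| ≤ N) :
    ∑ d ∈ T, ∑ ν ∈ rootsNegOne d, ‖trigPoly S a (ν / (d / g : ℕ))‖ ^ 2 ≤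
      32 * g * (D + N) * ∑ n ∈ S, ‖a n‖ ^ 2 := by
  rcases T.eq_empty_or_nonempty with h | ⟨d₀, hd₀⟩
  · subst h
    simp only [sum_empty]
    positivity
  have hpos : ∀ d ∈ T, 0 < g ∧ 0 < d / g ∧ d = g * (d / g) := by
    intro d hd
    obtain ⟨⟨q, hq⟩, h2, h3⟩ := hT d hd
    have hg : 0 < g := by
      rcases Nat.eq_zero_or_pos g with h | h
      · subst h; simp at h2 h3; exfalso; rw [h3] at h2; simp at h2
      · exact h
    have hd0 : 0 < d := by
      have : (0 : ℝ) < d := lt_of_le_of_lt (by positivity) h2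
      exact_mod_cast this
    refine ⟨hg, ?_, (Nat.mul_div_cancel' ⟨q, hq⟩).symm⟩
    exact Nat.div_pos (Nat.le_of_dvd hd0 ⟨q, hq⟩) hg
  have hg : 0 < g := (hpos d₀ hd₀).1
  have hgR : (0 : ℝ) < g := by exact_mod_cast hg
  have hqD : ∀ d ∈ T, D < (d / g : ℕ) ∧ ((d / g : ℕ) : ℝ) ≤ 2 * D := by
    intro d hd
    obtain ⟨_, h2, h3⟩ := hT d hd
    have h4 : (d : ℝ) = g * (d / g : ℕ) := by exact_mod_cast (hpos d hd).2.2
    rw [h4] at h2 h3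
    constructor
    · nlinarith
    · have : (g : ℝ) * (d / g : ℕ) ≤ g * (2 * D) := by linarith
      exact le_of_mul_le_mul_left this hgR
  have hD2 : 1 / 2 ≤ D := by
    have h1 := (hqD d₀ hd₀).2
    have h2 : (1 : ℝ) ≤ (d₀ / g : ℕ) := by exact_mod_cast (hpos d₀ hd₀).2.1
    linarith
  -- Here D is the size of q = d/g. As |q − q'| ≤ D/2, the points are at least 1/(4D) ≥ 2η apart,
  -- and N in the denominator ensures |n|η ≤ 1/8. Since ν < d = gq, they lie in [0, g].
  have hη : 0 < 1 / (8 * (D + N)) := by positivity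
  have := large_sieve (T.sigma rootsNegOne) (fun p => (p.2 : ℝ) / (p.1 / g : ℕ)) g S a hη
    (by
      rw [div_le_div_iff₀ (by positivity) (by norm_num)]
      linarith)
    (fun n hn => by
      have := hS n hn
      rw [mul_one_div, div_le_div_iff₀ (by positivity) (by norm_num)]
      linarith)
    (fun p _ => by positivity)
    (fun p hp => by
      rw [mem_sigma, mem_rootsNegOne] at hp
      obtain ⟨_, h2, h3⟩ := hpos _ hp.1
      have h4 : (0 : ℝ) < (p.1 / g : ℕ) := by exact_mod_cast h2
      rw [div_le_iff₀ h4]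
      have h5 : p.2 ≤ g * (p.1 / g) := by rw [← h3]; exact hp.2.1.le
      exact_mod_cast h5)
    (fun p hp p' hp' hne => by
      rw [mem_sigma, mem_rootsNegOne] at hp hp'
      obtain ⟨_, h2, h3⟩ := hpos _ hp.1
      obtain ⟨_, h2', h3'⟩ := hpos _ hp'.1
      obtain ⟨h6, h7⟩ := hqD _ hp.1
      obtain ⟨h6', h7'⟩ := hqD _ hp'.1
      have hclose := hT' _ hp.1 _ hp'.1
      obtain ⟨d, ν⟩ := p
      obtain ⟨d', ν'⟩ := p'
      simp only at *
      have hdR : (d : ℝ) = g * (d / g : ℕ) := by exact_mod_cast h3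
      have hdR' : (d' : ℝ) = g * (d' / g : ℕ) := by exact_mod_cast h3'
      rw [hdR, hdR'] at hclose
      have hsp := root_spacing h2 h2' ((Dvd.intro_left g h3.symm).trans hp.2.2)
        ((Dvd.intro_left g h3'.symm).trans hp'.2.2) (by
          rintro h
          rw [Prod.mk.injEq] at h
          apply hne
          have : d = d' := by rw [h3, h3', h.1]
          subst this
          rw [h.2])
      generalize d / g = q at *
      generalize d' / g = q' at *
      have hclose' : |(q : ℝ) - q'| ≤ D / 2 := by
        rw [← mul_sub, abs_mul, abs_of_pos hgR] at hclose
        refine le_of_mul_le_mul_left (hclose.trans (le_of_eq ?_)) hgR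
        ring
      have hq0 : (0 : ℝ) < q := by linarith
      have hq0' : (0 : ℝ) < q' := by linarith
      have h8 : ((q : ℝ) - q') ^ 2 ≤ (D / 2) ^ 2 := by
        rw [← sq_abs]; gcongr
      have h9 : (q * q' / (4 * D)) ^ 2 ≤ ((ν : ℝ) * q' - ν' * q) ^ 2 := by
        have h10 : (q : ℝ) * q' ≤ 4 * D ^ 2 := by nlinarith
        have h11 : D ^ 2 ≤ (q : ℝ) * q' := by nlinarith
        have h12 : (q * q' / (4 * D)) ^ 2 ≤ (q : ℝ) * q' / 4 := by
          rw [div_pow, div_le_div_iff₀ (by positivity) (by norm_num)]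
          nlinarith [mul_le_mul_of_nonneg_left h10 (by positivity : 0 ≤ (q : ℝ) * q')]
        nlinarith
      have h13 := sq_le_sq.mp h9
      rw [abs_of_pos (by positivity)] at h13
      rw [div_sub_div _ _ hq0.ne' hq0'.ne', abs_div, abs_of_pos (by positivity : (0 : ℝ) < q * q'),
        le_div_iff₀ (by positivity), mul_comm (q : ℝ) (ν' : ℝ)]
      refine le_trans ?_ h13
      rw [mul_one_div, div_mul_eq_mul_div, div_le_div_iff₀ (by positivity) (by positivity)]
      have h14 : (0 : ℝ) ≤ q * q' * N := by positivity
      linarith)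
  rw [sum_sigma] at this
  refine this.trans ?_
  have hg1 : (1 : ℝ) ≤ g := by exact_mod_cast hg
  gcongr
  rw [div_div_eq_mul_div, div_one]
  nlinarith [mul_nonneg (sub_nonneg.mpr hg1) (by positivity : 0 ≤ D + N)]

/-- Cutting the range of d at 3/2·Dg keeps |q − q'| ≤ D/2 within each half, as the spacing argument
needs; this doubles the constant. -/
theorem large_sieve_roots {D N : ℝ} {g : ℕ} (hD : 0 < D) (hN : 0 ≤ N) (T : Finset ℕ)
    (hT : ∀ d ∈ T, g ∣ d ∧ D * g < d ∧ (d : ℝ) ≤ 2 * D * g)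
    (S : Finset ℤ) (a : ℤ → ℂ) (hS : ∀ n ∈ S, |(n : ℝ)| ≤ N) :
    ∑ d ∈ T, ∑ ν ∈ rootsNegOne d, ‖trigPoly S a (ν / (d / g : ℕ))‖ ^ 2 ≤
      64 * g * (D + N) * ∑ n ∈ S, ‖a n‖ ^ 2 := by
  rw [← sum_filter_add_sum_filter_not T (fun d : ℕ => (d : ℝ) ≤ 3 / 2 * (D * g))]
  have h1 := large_sieve_roots_short hD hN (T.filter (fun d : ℕ => (d : ℝ) ≤ 3 / 2 * (D * g)))
    (fun d hd => hT d (mem_filter.mp hd).1)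
    (fun d hd d' hd' => by
      rw [mem_filter] at hd hd'
      have := hT d hd.1
      have := hT d' hd'.1
      rw [abs_le]; constructor <;> linarith) S a hS
  have h2 := large_sieve_roots_short hD hN (T.filter (fun d : ℕ => ¬ (d : ℝ) ≤ 3 / 2 * (D * g)))
    (fun d hd => hT d (mem_filter.mp hd).1)
    (fun d hd d' hd' => by
      rw [mem_filter, not_le] at hd hd'
      have := hT d hd.1
      have := hT d' hd'.1
      rw [abs_le]; constructor <;> linarith) S a hS
  linarith

/-! ### Fourier coefficients and Poisson summation. -/

open scoped FourierTransform

/-- The Fourier coefficients of the periodization of `t ↦ g(κt - s)`. -/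
def pcoef (g : ℝ → ℂ) (κ s : ℝ) (h : ℤ) : ℂ := ∫ t : ℝ, g (κ * t - s) * ex (-(h * t))

theorem hasCompactSupport_comp_affine {g : ℝ → ℂ} (hg : HasCompactSupport g) {κ : ℝ}
    (hκ : κ ≠ 0) (s : ℝ) : HasCompactSupport fun t => g (κ * t - s) := by
  have h : Topology.IsClosedEmbedding fun t : ℝ => κ * t - s := by
    have := ((Homeomorph.mulLeft₀ κ hκ).trans (Homeomorph.addRight (-s))).isClosedEmbedding
    convert! this using 1
  exact hg.comp_isClosedEmbedding h

/-- Integration by parts. Used twice, it gives the decay that permits truncation; used once, as an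
identity, it gives the gain in high frequency blocks. -/
theorem pcoef_eq_deriv {g : ℝ → ℂ} (hg : ContDiff ℝ 1 g) (hgc : HasCompactSupport g) {κ : ℝ}
    (hκ : κ ≠ 0) (s : ℝ) {h : ℤ} (hh : h ≠ 0) :
    pcoef g κ s h = κ / (2 * Real.pi * Complex.I * h) * pcoef (deriv g) κ s h := by
  have hc : (2 * Real.pi * Complex.I * h : ℂ) ≠ 0 := by simp [Real.pi_ne_zero, hh]
  have hd : Differentiable ℝ g := hg.differentiable one_ne_zero
  have hdc : Continuous (deriv g) := hg.continuous_deriv le_rfl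
  have hexc : Continuous fun t : ℝ => ex (-(h * t)) := continuous_ex.comp (by fun_prop)
  have hcs := hasCompactSupport_comp_affine hgc hκ s
  have hcs' := hasCompactSupport_comp_affine hgc.deriv hκ s
  have hgcont : Continuous fun t => g (κ * t - s) := hg.continuous.comp (by fun_prop)
  have hgcont' : Continuous fun t => deriv g (κ * t - s) := hdc.comp (by fun_prop)
  have hu : ∀ t : ℝ, HasDerivAt (fun t => g (κ * t - s)) (κ * deriv g (κ * t - s)) t := by
    intro t
    have h1 : HasDerivAt (fun t : ℝ => κ * t - s) κ t := by
      simpa using ((hasDerivAt_id t).const_mul κ).sub_const s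
    have h2 := (hd (κ * t - s)).hasDerivAt.scomp t h1
    simpa using! h2
  have hv : ∀ t : ℝ, HasDerivAt (fun t => ex (-(h * t)) / -(2 * Real.pi * Complex.I * h))
      (ex (-(h * t))) t := by
    intro t
    have h1 := (hasDerivAt_ex (-h) t).div_const (-(2 * Real.pi * Complex.I * h))
    have h2 : (2 * Real.pi * Complex.I * ((-h : ℝ) : ℂ)) = -(2 * Real.pi * Complex.I * h) := by
      push_cast; ring
    rw [h2, mul_div_cancel_left₀ _ (neg_ne_zero.mpr hc)] at h1
    simpa only [neg_mul] using h1
  have key := integral_mul_deriv_eq_deriv_mul_of_integrable (fun t _ => hu t) (fun t _ => hv t)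
    ((hgcont.mul hexc).integrable_of_hasCompactSupport hcs.mul_right)
    (((continuous_const.mul hgcont').mul (hexc.div_const _)).integrable_of_hasCompactSupport
      hcs'.mul_left.mul_right)
    ((hgcont.mul (hexc.div_const _)).integrable_of_hasCompactSupport hcs.mul_right)
  rw [pcoef, key, pcoef, ← integral_const_mul, ← integral_neg]
  congr 1
  ext t
  field_simp

theorem norm_pcoef_le {g : ℝ → ℂ} {κ : ℝ} (hκ : 0 < κ) (s : ℝ) (h : ℤ) :
    ‖pcoef g κ s h‖ ≤ κ⁻¹ * ∫ t, ‖g t‖ := by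
  refine (norm_integral_le_integral_norm _).trans (le_of_eq ?_)
  simp only [norm_mul, norm_ex, mul_one]
  rw [Measure.integral_comp_mul_left (fun t => ‖g (t - s)‖) κ,
    integral_sub_right_eq_self (fun t => ‖g t‖), abs_of_pos (inv_pos.mpr hκ), smul_eq_mul]

theorem norm_pcoef_le_inv_sq {g : ℝ → ℂ} (hg : ContDiff ℝ 2 g) (hgc : HasCompactSupport g) {κ : ℝ}
    (hκ : 0 < κ) (s : ℝ) {h : ℤ} (hh : h ≠ 0) :
    ‖pcoef g κ s h‖ ≤ κ * (∫ t, ‖deriv (deriv g) t‖) / (h : ℝ) ^ 2 := by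
  have hg' : ContDiff ℝ 1 (deriv g) := ((contDiff_succ_iff_deriv (n := 1)).mp hg).2.2
  rw [pcoef_eq_deriv (hg.of_le (by norm_num)) hgc hκ.ne' s hh,
    pcoef_eq_deriv hg' hgc.deriv hκ.ne' s hh, ← mul_assoc, norm_mul]
  have h1 := norm_pcoef_le (g := deriv (deriv g)) hκ s h
  have hI : 0 ≤ ∫ t, ‖deriv (deriv g) t‖ := integral_nonneg fun t => norm_nonneg _
  have hh' : (0 : ℝ) < (h : ℝ) ^ 2 := by positivity
  have h2 : ‖(κ / (2 * Real.pi * Complex.I * h) * (κ / (2 * Real.pi * Complex.I * h)) : ℂ)‖ ≤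
      κ ^ 2 / (h : ℝ) ^ 2 := by
    have h3 : ‖(2 * Real.pi * Complex.I * h : ℂ)‖ ^ 2 = (2 * Real.pi) ^ 2 * (h : ℝ) ^ 2 := by
      simp [mul_pow]
    rw [← sq, norm_pow, norm_div, Complex.norm_real, Real.norm_of_nonneg hκ.le, div_pow, h3]
    gcongr
    have : (1 : ℝ) ≤ (2 * Real.pi) ^ 2 := by nlinarith [Real.pi_gt_three]
    nlinarith
  calc _ ≤ κ ^ 2 / (h : ℝ) ^ 2 * (κ⁻¹ * ∫ t, ‖deriv (deriv g) t‖) := by gcongr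
    _ = _ := by field_simp

theorem fourier_eq_pcoef (g : ℝ → ℂ) (κ s : ℝ) (h : ℤ) :
    𝓕 (fun t => g (κ * t - s)) (h : ℝ) = pcoef g κ s h := by
  rw [Real.fourier_real_eq_integral_exp_smul, pcoef]
  congr 1
  ext t
  rw [smul_eq_mul, mul_comm, ex]
  congr 3
  push_cast; ring

/-- Poisson summation with an explicit truncation error. -/
theorem exists_poisson_truncation {g : ℝ → ℂ} (hg : ContDiff ℝ 2 g) (hgc : HasCompactSupport g) :
    ∃ C : ℝ, 0 ≤ C ∧ ∀ (κ s θ : ℝ) (T : ℕ), 0 < κ → 0 < T →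
      ‖∑' j : ℤ, g (κ * (θ + j) - s) - ∑ h ∈ Ioo (-T : ℤ) T, pcoef g κ s h * ex (h * θ)‖ ≤
        C * κ / Real.sqrt T := by
  set I := ∫ t, ‖deriv (deriv g) t‖ with hIdef
  have hI : 0 ≤ I := integral_nonneg fun t => norm_nonneg _
  have hS := Real.summable_abs_int_rpow (b := 3 / 2) (by norm_num)
  have hS2 := Real.summable_abs_int_rpow (b := 2) (by norm_num)
  refine ⟨I * ∑' n : ℤ, |(n : ℝ)| ^ (-(3 / 2) : ℝ),
    mul_nonneg hI (tsum_nonneg fun n => by positivity), ?_⟩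
  intro κ s θ T hκ hT
  have hTR : (0 : ℝ) < T := by exact_mod_cast hT
  have hcs := hasCompactSupport_comp_affine hgc hκ.ne' s
  have hdecay : (fun t => g (κ * t - s)) =O[Filter.cocompact ℝ] (fun x : ℝ => |x| ^ (-2 : ℝ)) := by
    rw [hasCompactSupport_iff_eventuallyEq, Filter.coclosedCompact_eq_cocompact] at hcs
    exact hcs.trans_isBigO (Asymptotics.isBigO_zero _ _)
  have hsumn : Summable fun h : ℤ => ‖pcoef g κ s h‖ := by
    refine Summable.of_norm_bounded_eventually (g := fun h : ℤ => κ * I * |(h : ℝ)| ^ (-2 : ℝ))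
      (hS2.mul_left _) ?_
    have : {(0 : ℤ)}ᶜ ∈ Filter.cofinite := (Set.finite_singleton (0 : ℤ)).compl_mem_cofinite
    filter_upwards [this] with h hh
    rw [norm_norm]
    refine (norm_pcoef_le_inv_sq hg hgc hκ s hh).trans (le_of_eq ?_)
    rw [Real.rpow_neg (abs_nonneg _), Real.rpow_two, sq_abs]
    rfl
  have hsum : Summable fun h : ℤ => pcoef g κ s h := hsumn.of_norm
  have hP := Real.tsum_eq_tsum_fourier_of_rpow_decay_of_summable (f := fun t => g (κ * t - s))
    (hg.continuous.comp (by fun_prop)) (b := 2) (by norm_num) hdecay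
    (by simpa only [fourier_eq_pcoef] using hsum) θ
  have hfour : ∀ h : ℤ, fourier h (θ : UnitAddCircle) = ex (h * θ) := by
    intro h
    rw [fourier_coe_apply, ex]
    congr 1
    push_cast
    ring
  simp only [fourier_eq_pcoef, hfour] at hP
  have hsum' : Summable fun h : ℤ => pcoef g κ s h * ex (h * θ) := by
    apply Summable.of_norm
    simpa only [norm_mul, norm_ex, mul_one] using hsumn
  rw [hP, ← hsum'.sum_add_tsum_compl (s := Ioo (-T : ℤ) T), add_sub_cancel_left]
  have hbd : ∀ h : ((Ioo (-T : ℤ) T : Set ℤ)ᶜ : Set ℤ), ‖pcoef g κ s h * ex ((h : ℤ) * θ)‖ ≤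
      I * κ / Real.sqrt T * |((h : ℤ) : ℝ)| ^ (-(3 / 2) : ℝ) := by
    rintro ⟨h, hh⟩
    rw [Set.mem_compl_iff, Finset.mem_coe, Finset.mem_Ioo] at hh
    have hTh : (T : ℝ) ≤ |(h : ℝ)| := by
      rw [← Int.cast_abs]
      have : (T : ℤ) ≤ |h| := by
        by_contra hlt
        exact hh (abs_lt.mp (not_le.mp hlt))
      exact_mod_cast this
    have hhpos : 0 < |(h : ℝ)| := hTR.trans_le hTh
    have hne : h ≠ 0 := by
      rintro rfl; simp at hhpos
    simp only [norm_mul, norm_ex, mul_one]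
    refine (norm_pcoef_le_inv_sq hg hgc hκ s hne).trans ?_
    -- Half a power of |h| ≥ T pays for T^(−1/2), and the exponent 3/2 left over still converges.
    -- The weak rate suffices because T will be a large power of all parameters.
    have h2 : (h : ℝ) ^ 2 = |(h : ℝ)| ^ (1 / 2 : ℝ) * |(h : ℝ)| ^ (3 / 2 : ℝ) := by
      rw [← Real.rpow_add hhpos, ← sq_abs, ← Real.rpow_natCast]; norm_num
    rw [h2, ← Real.sqrt_eq_rpow, Real.rpow_neg hhpos.le, ← hIdef, ← div_div, ← div_eq_mul_inv,
      mul_comm κ I]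
    gcongr
  refine (tsum_of_norm_bounded ((hS.mul_left _).subtype _).hasSum hbd).trans ?_
  refine (Summable.tsum_subtype_le _ _ (fun n => by positivity) (hS.mul_left _)).trans ?_
  rw [tsum_mul_left]
  exact le_of_eq (by ring)

/-! ### Opening the congruence sum and its expected term. -/

/-- If d ∣ l² + m² with l, m coprime, then l is invertible modulo d and the only candidate is ν ≡
m/l. Conversely m ≡ νl gives l² + m² ≡ l²(ν² + 1) ≡ 0. -/
theorem card_root_fiber {d l : ℕ} {m : ℤ} (hd : 0 < d) (hg : Int.gcd (l : ℤ) m = 1) :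
    ((rootsNegOne d).filter (fun ν : ℕ => (d : ℤ) ∣ m - ν * l)).card =
      if (d : ℤ) ∣ (l : ℤ) ^ 2 + m ^ 2 then 1 else 0 := by
  have hdZ : (0 : ℤ) < d := by exact_mod_cast hd
  split_ifs with h
  · have hcop : IsCoprime (d : ℤ) (l : ℤ) := by
      have h1 : IsCoprime ((l : ℤ) ^ 2) ((l : ℤ) ^ 2 + m ^ 2) := by
        have : IsCoprime ((l : ℤ) ^ 2) (m ^ 2) := (Int.isCoprime_iff_gcd_eq_one.mpr hg).pow
        have := this.mul_add_left_right 1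
        rwa [mul_one] at this
      have h2 := (h1.of_isCoprime_of_dvd_right h).symm
      exact h2.of_isCoprime_of_dvd_right (dvd_pow_self _ two_ne_zero)
    obtain ⟨u, v, huv⟩ := hcop
    -- `v` is an inverse of `l` modulo `d`
    have hν0 : 0 ≤ (m * v) % d := Int.emod_nonneg _ hdZ.ne'
    have hνd : (m * v) % d < d := Int.emod_lt_of_pos _ hdZ
    obtain ⟨ν, hν⟩ := Int.eq_ofNat_of_zero_le hν0
    have hmod : (d : ℤ) ∣ m * v - ν := by
      rw [← hν]; exact Int.dvd_self_sub_emod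
    have hml : (d : ℤ) ∣ m - ν * l := by
      have : m - ν * l = (m * v - ν) * l + d * (m * u) := by
        linear_combination (-m) * huv
      rw [this]
      exact dvd_add (hmod.mul_right _) (dvd_mul_right _ _)
    rw [card_eq_one]
    refine ⟨ν, ?_⟩
    ext x
    simp only [mem_filter, mem_rootsNegOne, mem_singleton]
    constructor
    · rintro ⟨⟨hx, _⟩, hx2⟩
      have h3 : (d : ℤ) ∣ l * ((x : ℤ) - ν) := by
        have : (l : ℤ) * ((x : ℤ) - ν) = (m - ν * l) - (m - x * l) := by ring
        rw [this]; exact dvd_sub hml hx2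
      have h4 : (d : ℤ) ∣ (x : ℤ) - ν := by
        have : (x : ℤ) - ν = d * (u * (x - ν)) + l * (x - ν) * v := by
          linear_combination (-((x : ℤ) - ν)) * huv
        rw [this]
        exact dvd_add (dvd_mul_right _ _) (h3.mul_right _)
      have h5 := Int.eq_zero_of_abs_lt_dvd h4 (by rw [abs_lt]; constructor <;> omega)
      omega
    · rintro rfl
      refine ⟨⟨by omega, ?_⟩, hml⟩
      have h6 : (d : ℤ) ∣ (l : ℤ) * (l * ((x : ℤ) ^ 2 + 1)) := by
        have : (l : ℤ) * (l * ((x : ℤ) ^ 2 + 1)) =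
            ((l : ℤ) ^ 2 + m ^ 2) - (m - x * l) * (m + x * l) := by ring
        rw [this]; exact dvd_sub h (hml.mul_right _)
      have hcop : IsCoprime (d : ℤ) (l : ℤ) := ⟨u, v, huv⟩
      have h7 := hcop.dvd_of_dvd_mul_left (hcop.dvd_of_dvd_mul_left h6)
      exact_mod_cast h7
  · rw [card_eq_zero, filter_eq_empty_iff]
    intro ν hν hdvd
    apply h
    rw [mem_rootsNegOne] at hν
    have h1 : (d : ℤ) ∣ (ν : ℤ) ^ 2 + 1 := by exact_mod_cast Int.natCast_dvd_natCast.mpr hν.2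
    have : (l : ℤ) ^ 2 + m ^ 2 = l ^ 2 * ((ν : ℤ) ^ 2 + 1) + (m - ν * l) * (m + ν * l) := by ring
    rw [this]
    exact dvd_add (h1.mul_left _) (hdvd.mul_right _)

open ArithmeticFunction in
-- Since b ∣ l, b divides m exactly when it divides m − νl; hence b ∣ m and the root congruence
-- modulo d become one condition modulo lcm(b, d).
theorem indicator_eq_sum_moebius {d l : ℕ} (hd : 0 < d) (hl : l ≠ 0) (m : ℤ) :
    (if Int.gcd (l : ℤ) m = 1 ∧ (d : ℤ) ∣ (l : ℤ) ^ 2 + m ^ 2 then (1 : ℂ) else 0) =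
      ∑ ν ∈ rootsNegOne d, ∑ b ∈ l.divisors, (moebius b : ℂ) *
        if ((Nat.lcm b d : ℕ) : ℤ) ∣ m - ν * l then 1 else 0 := by
  have h1 : ∀ ν ∈ rootsNegOne d, ∑ b ∈ l.divisors, (moebius b : ℂ) *
      (if ((Nat.lcm b d : ℕ) : ℤ) ∣ m - ν * l then 1 else 0) =
      (if (d : ℤ) ∣ m - ν * l then 1 else 0) * if Int.gcd (l : ℤ) m = 1 then 1 else 0 := by
    intro ν _
    have h2 : ∀ b ∈ l.divisors, (moebius b : ℂ) *
        (if ((Nat.lcm b d : ℕ) : ℤ) ∣ m - ν * l then 1 else 0) =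
        (if (d : ℤ) ∣ m - ν * l then 1 else 0) * if (b : ℤ) ∣ m then (moebius b : ℂ) else 0 := by
      intro b hb
      have hbl : (b : ℤ) ∣ ν * l :=
        (Int.natCast_dvd_natCast.mpr (Nat.dvd_of_mem_divisors hb)).mul_left _
      have h3 : ((Nat.lcm b d : ℕ) : ℤ) ∣ m - ν * l ↔ (b : ℤ) ∣ m ∧ (d : ℤ) ∣ m - ν * l := by
        rw [← dvd_sub_left hbl (b := m), Int.natCast_dvd, Nat.lcm_dvd_iff, Int.natCast_dvd,
          Int.natCast_dvd]
      by_cases hbm : (b : ℤ) ∣ m <;> by_cases hdm : (d : ℤ) ∣ m - ν * l <;> simp [h3, hbm, hdm]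
    rw [sum_congr rfl h2, ← mul_sum, ← sum_filter]
    have := sum_moebius_filter_dvd hl m
    rw [← Int.cast_sum, this]
    simp
  rw [sum_congr rfl h1, ← sum_mul, ← sum_filter, sum_const, nsmul_eq_mul, mul_one]
  by_cases hg : Int.gcd (l : ℤ) m = 1
  · rw [card_root_fiber hd hg]
    by_cases hdm : (d : ℤ) ∣ (l : ℤ) ^ 2 + m ^ 2 <;> simp [hg, hdm]
  · simp [hg]

theorem finite_support_dilate {ψ : ℝ → ℂ} (hψc : HasCompactSupport ψ) {M : ℝ} (hM : 0 < M)
    (m₀ : ℝ) : (Function.support fun m : ℤ => dilate ψ M ((m : ℝ) - m₀)).Finite := by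
  obtain ⟨R, hR⟩ := hψc.isCompact.isBounded.subset_closedBall 0
  refine (Set.finite_Icc ⌊m₀ - R * M⌋ ⌈m₀ + R * M⌉).subset fun m hm => ?_
  have h1 := hR (subset_tsupport _ (Function.mem_support.mpr hm : ((m : ℝ) - m₀) / M ∈ _))
  rw [mem_closedBall_zero_iff, Real.norm_eq_abs, abs_le, le_div_iff₀ hM, div_le_iff₀ hM] at h1
  constructor
  · have h2 := Int.floor_le (m₀ - R * M)
    have : (⌊m₀ - R * M⌋ : ℝ) ≤ m := by linarith
    exact_mod_cast this
  · have h2 := Int.le_ceil (m₀ + R * M)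
    have : (m : ℝ) ≤ ⌈m₀ + R * M⌉ := by linarith
    exact_mod_cast this

theorem tsum_residue_class {f : ℤ → ℂ} {Q : ℕ} (hQ : 0 < Q) (r : ℤ) :
    ∑' m : ℤ, (if (Q : ℤ) ∣ m - r then f m else 0) = ∑' j : ℤ, f (r + Q * j) := by
  have hQ' : (Q : ℤ) ≠ 0 := by exact_mod_cast hQ.ne'
  have hinj : Function.Injective fun j : ℤ => r + Q * j := by
    intro x y hxy
    simpa [hQ.ne'] using hxy
  rw [← hinj.tsum_eq]
  · congr 1
    ext j
    simp
  · intro m hm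
    rw [Function.mem_support] at hm
    have : (Q : ℤ) ∣ m - r := by
      by_contra h
      exact hm (if_neg h)
    obtain ⟨j, hj⟩ := this
    exact ⟨j, by simp only; omega⟩

open ArithmeticFunction in
-- Each class is put in the form ψ(κ(θ + j) − s) with κ = lcm(b, d)/M, θ = νl/lcm(b, d), s = m₀/M,
-- ready for Poisson summation.
theorem congruenceSum_eq {ψ : ℝ → ℂ} (hψc : HasCompactSupport ψ) {M : ℝ} (hM : 0 < M)
    (L m₀ : ℝ) (a : ℕ → ℂ) {d : ℕ} (hd : 0 < d) :
    congruenceSum ψ M L m₀ a d = ∑ l ∈ dyadic L, a l * ∑ ν ∈ rootsNegOne d, ∑ b ∈ l.divisors,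
      (moebius b : ℂ) * ∑' j : ℤ, ψ (((Nat.lcm b d : ℕ) : ℝ) / M *
        ((ν * l : ℝ) / (Nat.lcm b d : ℕ) + j) - m₀ / M) := by
  unfold congruenceSum
  refine sum_congr rfl fun l hl => ?_
  have hl0 : l ≠ 0 := by
    rw [dyadic, mem_Ioc] at hl; omega
  set f : ℤ → ℂ := fun m => dilate ψ M ((m : ℝ) - m₀) with hf
  have hfin : (Function.support f).Finite := finite_support_dilate hψc hM m₀
  have h1 : ∀ m : ℤ, (if Int.gcd (l : ℤ) m = 1 ∧ (d : ℤ) ∣ (l : ℤ) ^ 2 + m ^ 2 then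
      a l * dilate ψ M ((m : ℝ) - m₀) else 0) = a l * ∑ ν ∈ rootsNegOne d, ∑ b ∈ l.divisors,
        (moebius b : ℂ) * if ((Nat.lcm b d : ℕ) : ℤ) ∣ m - ν * l then f m else 0 := by
    intro m
    have h2 : (if Int.gcd (l : ℤ) m = 1 ∧ (d : ℤ) ∣ (l : ℤ) ^ 2 + m ^ 2 then
      a l * dilate ψ M ((m : ℝ) - m₀) else 0) = a l * ((if Int.gcd (l : ℤ) m = 1 ∧
        (d : ℤ) ∣ (l : ℤ) ^ 2 + m ^ 2 then (1 : ℂ) else 0) * f m) := by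
      split_ifs <;> simp [hf]
    rw [h2, indicator_eq_sum_moebius hd hl0, sum_mul]
    congr 1
    refine sum_congr rfl fun ν _ => ?_
    rw [sum_mul]
    refine sum_congr rfl fun b _ => ?_
    split_ifs <;> simp
  have hs : ∀ (ν b : ℕ), Summable fun m : ℤ => (moebius b : ℂ) *
      if ((Nat.lcm b d : ℕ) : ℤ) ∣ m - ν * l then f m else 0 := by
    intro ν b
    refine summable_of_hasFiniteSupport (hfin.subset fun m hm => ?_)
    rw [Function.mem_support] at hm ⊢
    rintro h0
    simp [h0] at hm
  simp only [h1]
  rw [tsum_mul_left]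
  congr 1
  rw [Summable.tsum_finsetSum fun ν _ => summable_sum fun b _ => hs ν b]
  refine sum_congr rfl fun ν _ => ?_
  rw [Summable.tsum_finsetSum fun b _ => hs ν b]
  refine sum_congr rfl fun b hb => ?_
  rw [tsum_mul_left]
  congr 1
  have hb0 : 0 < b := Nat.pos_of_mem_divisors hb
  have hQ : 0 < Nat.lcm b d := Nat.lcm_pos hb0 hd
  rw [tsum_residue_class hQ]
  congr 1
  ext j
  have hQ' : ((Nat.lcm b d : ℕ) : ℝ) ≠ 0 := by exact_mod_cast hQ.ne'
  simp only [hf, dilate]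
  congr 1
  push_cast
  field_simp

theorem pcoef_zero (ψ : ℝ → ℂ) {M Q : ℝ} (hM : 0 < M) (hQ : 0 < Q) (s : ℝ) :
    pcoef ψ (Q / M) s 0 = (∫ t : ℝ, dilate ψ M t) / Q := by
  unfold pcoef dilate
  have h1 : (0 : ℝ) < Q / M := by positivity
  simp only [Int.cast_zero, zero_mul, neg_zero, ex_zero, mul_one]
  rw [Measure.integral_comp_mul_left (fun t => ψ (t - s)), integral_sub_right_eq_self ψ,
    Measure.integral_comp_div, abs_of_pos (inv_pos.mpr h1), abs_of_pos hM, inv_div]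
  rw [Complex.real_smul, Complex.real_smul]
  push_cast
  ring

open ArithmeticFunction in
-- The zero frequencies reproduce the main term with no error: counting ν gives ϱ(d), and
-- `sum_moebius_div_lcm` gives φ(l)/l with the condition (l, d) = 1. The shift `s` is arbitrary
-- because it does not affect frequency 0.
theorem expectedTerm_eq (ψ : ℝ → ℂ) {M : ℝ} (hM : 0 < M)
    (L s : ℝ) (a : ℕ → ℂ) {d : ℕ} (hd : 0 < d) :
    expectedTerm ψ M L a d = ∑ l ∈ dyadic L, a l * ∑ _ν ∈ rootsNegOne d, ∑ b ∈ l.divisors,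
      (moebius b : ℂ) * pcoef ψ (((Nat.lcm b d : ℕ) : ℝ) / M) s 0 := by
  unfold expectedTerm
  rw [sum_filter, mul_sum]
  refine sum_congr rfl fun l hl => ?_
  have hl0 : l ≠ 0 := by
    rw [dyadic, mem_Ioc] at hl; omega
  have h1 : ∀ b ∈ l.divisors, (moebius b : ℂ) * pcoef ψ (((Nat.lcm b d : ℕ) : ℝ) / M) s 0 =
      (∫ t : ℝ, dilate ψ M t) * ((moebius b : ℂ) / (Nat.lcm b d : ℂ)) := by
    intro b hb
    have hQ : 0 < Nat.lcm b d := Nat.lcm_pos (Nat.pos_of_mem_divisors hb) hd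
    rw [pcoef_zero ψ hM (by exact_mod_cast hQ)]
    push_cast
    ring
  rw [sum_congr rfl h1, ← mul_sum, sum_moebius_div_lcm hl0 hd.ne', sum_const, nsmul_eq_mul,
    card_rootsNegOne]
  split_ifs
  · ring
  · ring

/-! ### Dyadic blocks of frequencies. -/

/-- The integers `h` with `2 ^ i ≤ |h| < 2 ^ (i + 1)`. -/
def freqBlock (i : ℕ) : Finset ℤ :=
  (Ioo (-(2 ^ (i + 1) : ℕ) : ℤ) (2 ^ (i + 1) : ℕ)).filter (fun h => ((2 ^ i : ℕ) : ℤ) ≤ |h|)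

theorem sum_Ioo_eq_sum_freqBlock {E : Type*} [AddCommMonoid E] (F : ℤ → E) (I : ℕ) :
    ∑ h ∈ Ioo (-(2 ^ I : ℕ) : ℤ) (2 ^ I : ℕ), F h = F 0 + ∑ i ∈ range I, ∑ h ∈ freqBlock i, F h := by
  induction I with
  | zero =>
    have : Ioo (-(2 ^ 0 : ℕ) : ℤ) (2 ^ 0 : ℕ) = {0} := by
      ext h
      simp only [mem_Ioo, mem_singleton]
      omega
    rw [this]; simp
  | succ I ih =>
    rw [sum_range_succ, ← add_assoc, ← ih]
    refine (sum_filter_add_sum_filter_not _ (fun h : ℤ => ((2 ^ I : ℕ) : ℤ) ≤ |h|) _).symm.trans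
      ((add_comm _ _).trans ?_)
    congr 1
    refine sum_congr ?_ fun _ _ => rfl
    ext h
    rw [mem_filter, mem_Ioo, mem_Ioo, not_le, abs_lt, pow_succ]
    constructor
    · exact fun h => h.2
    · intro h
      refine ⟨⟨?_, ?_⟩, h⟩ <;> push_cast at * <;> linarith

/-- The contribution of one block of frequencies. -/
def blockSum (ψ : ℝ → ℂ) (M L m₀ : ℝ) (a : ℕ → ℂ) (b i d ν : ℕ) : ℂ :=
  ∑ l ∈ (dyadic L).filter (fun l => b ∣ l), a l * ∑ h ∈ freqBlock i,
    pcoef ψ (((Nat.lcm b d : ℕ) : ℝ) / M) (m₀ / M) h * ex (h * ((ν * l : ℝ) / (Nat.lcm b d : ℕ)))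

open ArithmeticFunction in
-- Once the zero frequency cancels, the sum over b is moved outside. Only squarefree b survive μ(b),
-- which later yields the saving 1/b for k-th powers.
theorem norm_congruenceSum_sub_le {ψ : ℝ → ℂ} (hψc : HasCompactSupport ψ) {C : ℝ}
    (hC : ∀ (κ s θ : ℝ) (T : ℕ), 0 < κ → 0 < T →
      ‖∑' j : ℤ, ψ (κ * (θ + j) - s) - ∑ h ∈ Ioo (-T : ℤ) T, pcoef ψ κ s h * ex (h * θ)‖ ≤
        C * κ / Real.sqrt T) {M : ℝ} (hM : 0 < M)
    (L m₀ : ℝ) {a : ℕ → ℂ} (ha : ∀ l, ‖a l‖ ≤ 1) {d : ℕ} (hd : 0 < d) (I : ℕ) :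
    ‖congruenceSum ψ M L m₀ a d - expectedTerm ψ M L a d‖ ≤
      (∑ b ∈ (Icc 1 ⌊2 * L⌋₊).filter Squarefree, ∑ i ∈ range I, ∑ ν ∈ rootsNegOne d,
        ‖blockSum ψ M L m₀ a b i d ν‖) +
      ∑ l ∈ dyadic L, ∑ _ν ∈ rootsNegOne d, ∑ b ∈ l.divisors,
        C * (((Nat.lcm b d : ℕ) : ℝ) / M) / Real.sqrt ((2 ^ I : ℕ) : ℝ) := by
  set Fp : ℕ → ℕ → ℕ → ℂ := fun l ν b => ∑' j : ℤ, ψ (((Nat.lcm b d : ℕ) : ℝ) / M *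
        ((ν * l : ℝ) / (Nat.lcm b d : ℕ) + j) - m₀ / M) with hFp
  set S : ℕ → ℕ → ℕ → ℕ → ℂ := fun l ν b i => ∑ h ∈ freqBlock i,
    pcoef ψ (((Nat.lcm b d : ℕ) : ℝ) / M) (m₀ / M) h *
      ex (h * ((ν * l : ℝ) / (Nat.lcm b d : ℕ))) with hS
  set c₀ : ℕ → ℂ := fun b => pcoef ψ (((Nat.lcm b d : ℕ) : ℝ) / M) (m₀ / M) 0 with hc₀
  have hmu : ∀ b : ℕ, ‖(moebius b : ℂ)‖ ≤ 1 := by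
    intro b
    rw [Complex.norm_intCast]
    exact_mod_cast abs_moebius_le_one
  have hr : ∀ l ν, ∀ b ∈ l.divisors, ‖Fp l ν b - c₀ b - ∑ i ∈ range I, S l ν b i‖ ≤
      C * (((Nat.lcm b d : ℕ) : ℝ) / M) / Real.sqrt ((2 ^ I : ℕ) : ℝ) := by
    intro l ν b hb
    have hQ : 0 < Nat.lcm b d := Nat.lcm_pos (Nat.pos_of_mem_divisors hb) hd
    have hQ' : (0 : ℝ) < (Nat.lcm b d : ℕ) := by exact_mod_cast hQ
    have h1 := hC (((Nat.lcm b d : ℕ) : ℝ) / M) (m₀ / M) ((ν * l : ℝ) / (Nat.lcm b d : ℕ)) (2 ^ I)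
      (by positivity) (by positivity)
    rw [sum_Ioo_eq_sum_freqBlock] at h1
    simp only [Int.cast_zero, zero_mul, ex_zero, mul_one] at h1
    rw [sub_sub]
    exact h1
  have hmain : congruenceSum ψ M L m₀ a d - expectedTerm ψ M L a d =
      (∑ l ∈ dyadic L, a l * ∑ ν ∈ rootsNegOne d, ∑ b ∈ l.divisors,
        (moebius b : ℂ) * ∑ i ∈ range I, S l ν b i) +
      ∑ l ∈ dyadic L, a l * ∑ ν ∈ rootsNegOne d, ∑ b ∈ l.divisors,
        (moebius b : ℂ) * (Fp l ν b - c₀ b - ∑ i ∈ range I, S l ν b i) := by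
    rw [congruenceSum_eq hψc hM L m₀ a hd, expectedTerm_eq ψ hM L (m₀ / M) a hd,
      ← sum_sub_distrib, ← sum_add_distrib]
    refine sum_congr rfl fun l _ => ?_
    rw [← mul_sub, ← mul_add, ← sum_sub_distrib, ← sum_add_distrib]
    congr 1
    refine sum_congr rfl fun ν _ => ?_
    rw [← sum_sub_distrib, ← sum_add_distrib]
    refine sum_congr rfl fun b _ => ?_
    ring
  have hdiv : ∀ l ∈ dyadic L, l.divisors = (Icc 1 ⌊2 * L⌋₊).filter (fun b => b ∣ l) := by
    intro l hl
    rw [dyadic, mem_Ioc] at hl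
    ext b
    rw [Nat.mem_divisors, mem_filter, mem_Icc]
    constructor
    · rintro ⟨h1, h2⟩
      exact ⟨⟨Nat.pos_of_dvd_of_pos h1 (by omega),
        (Nat.le_of_dvd (by omega) h1).trans hl.2⟩, h1⟩
    · rintro ⟨_, h2⟩
      exact ⟨h2, by omega⟩
  have hswap : (∑ l ∈ dyadic L, a l * ∑ ν ∈ rootsNegOne d, ∑ b ∈ l.divisors,
        (moebius b : ℂ) * ∑ i ∈ range I, S l ν b i) =
      ∑ b ∈ Icc 1 ⌊2 * L⌋₊, ∑ i ∈ range I, ∑ ν ∈ rootsNegOne d,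
        (moebius b : ℂ) * blockSum ψ M L m₀ a b i d ν := by
    have h1 : (∑ l ∈ dyadic L, a l * ∑ ν ∈ rootsNegOne d, ∑ b ∈ l.divisors,
        (moebius b : ℂ) * ∑ i ∈ range I, S l ν b i) =
        ∑ l ∈ dyadic L, ∑ b ∈ Icc 1 ⌊2 * L⌋₊, ∑ i ∈ range I, ∑ ν ∈ rootsNegOne d,
        if b ∣ l then (moebius b : ℂ) * (a l * S l ν b i) else 0 := by
      refine sum_congr rfl fun l hl => ?_
      rw [sum_comm, hdiv l hl, sum_filter, mul_sum]
      refine sum_congr rfl fun b _ => ?_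
      split_ifs
      · rw [sum_comm, mul_sum]
        refine sum_congr rfl fun ν _ => ?_
        rw [mul_sum, mul_sum]
        refine sum_congr rfl fun i _ => ?_
        ring
      · simp
    rw [h1, sum_comm]
    refine sum_congr rfl fun b _ => ?_
    rw [sum_comm]
    refine sum_congr rfl fun i _ => ?_
    rw [sum_comm]
    refine sum_congr rfl fun ν _ => ?_
    rw [blockSum, sum_filter, mul_sum]
    refine sum_congr rfl fun l _ => ?_
    split_ifs
    · rfl
    · simp
  rw [hmain, hswap]
  refine (norm_add_le _ _).trans (add_le_add ?_ ?_)
  · rw [sum_filter]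
    refine norm_sum_le_of_le _ fun b _ => ?_
    split_ifs with hb
    · refine norm_sum_le_of_le _ fun i _ => norm_sum_le_of_le _ fun ν _ => ?_
      rw [norm_mul]
      exact mul_le_of_le_one_left (norm_nonneg _) (hmu b)
    · rw [moebius_eq_zero_of_not_squarefree hb]
      simp
  · refine norm_sum_le_of_le _ fun l _ => ?_
    rw [norm_mul]
    refine (mul_le_of_le_one_left (norm_nonneg _) (ha l)).trans ?_
    refine norm_sum_le_of_le _ fun ν _ => norm_sum_le_of_le _ fun b hb => ?_
    rw [norm_mul]
    exact (mul_le_of_le_one_left (norm_nonneg _) (hmu b)).trans (hr l ν b hb)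

/-- The moduli are sorted by g = gcd(b, d) because lcm(b, d) = b(d/g): on each class the sieve runs
over fractions with denominator d/g. -/
theorem norm_typeIError_le {ψ : ℝ → ℂ} (hψc : HasCompactSupport ψ) {C : ℝ}
    (hC : ∀ (κ s θ : ℝ) (T : ℕ), 0 < κ → 0 < T →
      ‖∑' j : ℤ, ψ (κ * (θ + j) - s) - ∑ h ∈ Ioo (-T : ℤ) T, pcoef ψ κ s h * ex (h * θ)‖ ≤
        C * κ / Real.sqrt T) {M : ℝ} (hM : 0 < M)
    (L D m₀ : ℝ) {a : ℕ → ℂ} (ha : ∀ l, ‖a l‖ ≤ 1) (α : ℕ → ℂ) (I : ℕ) :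
    ‖typeIError ψ M L D m₀ a α‖ ≤
      (∑ b ∈ (Icc 1 ⌊2 * L⌋₊).filter Squarefree, ∑ i ∈ range I, ∑ g ∈ b.divisors,
        ∑ d ∈ (dyadic D).filter (fun d => Nat.gcd b d = g), ‖α d‖ * ∑ ν ∈ rootsNegOne d,
        ‖blockSum ψ M L m₀ a b i d ν‖) +
      ∑ d ∈ dyadic D, ‖α d‖ * ∑ l ∈ dyadic L, ∑ _ν ∈ rootsNegOne d, ∑ b ∈ l.divisors,
        C * (((Nat.lcm b d : ℕ) : ℝ) / M) / Real.sqrt ((2 ^ I : ℕ) : ℝ) := by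
  have h1 : (∑ b ∈ (Icc 1 ⌊2 * L⌋₊).filter Squarefree, ∑ i ∈ range I, ∑ g ∈ b.divisors,
        ∑ d ∈ (dyadic D).filter (fun d => Nat.gcd b d = g), ‖α d‖ * ∑ ν ∈ rootsNegOne d,
        ‖blockSum ψ M L m₀ a b i d ν‖) =
      ∑ d ∈ dyadic D, ‖α d‖ * ∑ b ∈ (Icc 1 ⌊2 * L⌋₊).filter Squarefree, ∑ i ∈ range I,
        ∑ ν ∈ rootsNegOne d, ‖blockSum ψ M L m₀ a b i d ν‖ := by
    simp only [mul_sum (filter Squarefree _), mul_sum (range I)]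
    symm
    rw [sum_comm]
    refine sum_congr rfl fun b hb => ?_
    rw [sum_comm]
    refine sum_congr rfl fun i _ => ?_
    refine (sum_fiberwise_of_maps_to (fun d _ => ?_) _).symm
    rw [mem_filter, mem_Icc] at hb
    exact Nat.mem_divisors.mpr ⟨Nat.gcd_dvd_left _ _, by omega⟩
  rw [h1, ← sum_add_distrib]
  refine norm_sum_le_of_le _ fun d hd => ?_
  have hd0 : 0 < d := by
    rw [dyadic, mem_Ioc] at hd; omega
  rw [norm_mul, ← mul_add]
  exact mul_le_mul_of_nonneg_left (norm_congruenceSum_sub_le hψc hC hM L m₀ ha hd0 I)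
    (norm_nonneg _)

/-! ### Separating the modulus d from the frequencies. -/

theorem norm_integral_mul_le {G F : ℝ → ℂ} (hG : Continuous G) (hF : Continuous F) {C₀ R κ s t₀ : ℝ}
    (hC₀ : ∀ x, ‖G x‖ ≤ C₀) (hR : ∀ x, R < |x| → G x = 0) (hκ : 0 < κ)
    (ht₀ : |s| + R ≤ κ * t₀) (ht₀' : 0 ≤ t₀) :
    ‖∫ t, G (κ * t - s) * F t‖ ≤ C₀ * ∫ t in (-t₀)..t₀, ‖F t‖ := by
  have h1 : ∀ t, t ∉ Set.Icc (-t₀) t₀ → G (κ * t - s) * F t = 0 := by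
    intro t ht
    rw [hR, zero_mul]
    have h2 : t₀ < |t| := by
      by_contra h
      exact ht (abs_le.mp (not_lt.mp h))
    have h3 : κ * t₀ < κ * |t| := mul_lt_mul_of_pos_left h2 hκ
    have h4 : κ * |t| = |κ * t| := by rw [abs_mul, abs_of_pos hκ]
    have h5 := abs_sub_abs_le_abs_sub (κ * t) s
    linarith
  have hc : Continuous fun t => G (κ * t - s) := hG.comp (by fun_prop)
  rw [← setIntegral_eq_integral_of_forall_compl_eq_zero h1, integral_Icc_eq_integral_Ioc,
    ← intervalIntegral.integral_of_le (by linarith), ← intervalIntegral.integral_const_mul]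
  refine (intervalIntegral.norm_integral_le_integral_norm (by linarith)).trans ?_
  refine intervalIntegral.integral_mono_on (by linarith)
    ((hc.mul hF).norm.intervalIntegrable _ _)
    ((continuous_const.mul hF.norm).intervalIntegrable _ _) fun t _ => ?_
  rw [norm_mul]
  exact mul_le_mul_of_nonneg_right (hC₀ _) (norm_nonneg _)

/-- The exponential sum attached to a block of frequencies `h`, twisted by `e(-ht)`. -/
def blockPoly (Λ : Finset ℕ) (a : ℕ → ℂ) (w : ℤ → ℂ) (b i : ℕ) (t x : ℝ) : ℂ :=
  ∑ l ∈ Λ, a l * ∑ h ∈ freqBlock i, w h * ex (-(h * t)) * ex (h * ((l / b : ℕ) * x))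

theorem continuous_blockPoly (Λ : Finset ℕ) (a : ℕ → ℂ) (w : ℤ → ℂ) (b i : ℕ) (x : ℝ) :
    Continuous fun t => blockPoly Λ a w b i t x := by
  unfold blockPoly
  refine continuous_finsetSum _ fun l _ => continuous_const.mul
    (continuous_finsetSum _ fun h _ => ?_)
  exact (continuous_const.mul (continuous_ex.comp (by fun_prop))).mul continuous_const

/-- Opening the Fourier integral confines κ, hence d, to the scalar G(κt − s). The exponential sum
left inside has coefficients independent of d, as the large sieve requires. -/
theorem sum_pcoef_eq_integral {G : ℝ → ℂ} (hG : Continuous G) (hGc : HasCompactSupport G) {κ : ℝ}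
    (hκ : κ ≠ 0) (s : ℝ) (Λ : Finset ℕ) (a : ℕ → ℂ) (w : ℤ → ℂ) (b i : ℕ) (x : ℝ) :
    ∑ l ∈ Λ, a l * ∑ h ∈ freqBlock i, w h * pcoef G κ s h * ex (h * ((l / b : ℕ) * x)) =
      ∫ t, G (κ * t - s) * blockPoly Λ a w b i t x := by
  have hc : Continuous fun t => G (κ * t - s) := hG.comp (by fun_prop)
  have hcs := hasCompactSupport_comp_affine hGc hκ s
  have hint : ∀ h : ℤ, Integrable fun t => G (κ * t - s) * ex (-(h * t)) := fun h =>
    (hc.mul (continuous_ex.comp (by fun_prop))).integrable_of_hasCompactSupport hcs.mul_right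
  have h1 : ∀ t, G (κ * t - s) * blockPoly Λ a w b i t x = ∑ l ∈ Λ, ∑ h ∈ freqBlock i,
      (a l * (w h * ex (h * ((l / b : ℕ) * x)))) * (G (κ * t - s) * ex (-(h * t))) := by
    intro t
    rw [blockPoly, mul_sum]
    refine sum_congr rfl fun l _ => ?_
    rw [mul_sum, mul_sum]
    refine sum_congr rfl fun h _ => ?_
    ring
  simp only [h1]
  rw [integral_finsetSum _ fun l _ => integrable_finsetSum _ fun h _ => (hint h).const_mul _]
  refine sum_congr rfl fun l _ => ?_
  rw [integral_finsetSum _ fun h _ => (hint h).const_mul _, mul_sum]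
  refine sum_congr rfl fun h _ => ?_
  rw [integral_const_mul, pcoef]
  ring

theorem lcm_eq_mul_div {b d g : ℕ} (h : Nat.gcd b d = g) : Nat.lcm b d = b * (d / g) := by
  rw [Nat.lcm, h, Nat.mul_div_assoc]
  rw [← h]; exact Nat.gcd_dvd_right b d

theorem mem_freqBlock {i : ℕ} {h : ℤ} :
    h ∈ freqBlock i ↔ (2 ^ i : ℝ) ≤ |(h : ℝ)| ∧ |(h : ℝ)| < 2 ^ (i + 1) := by
  rw [freqBlock, mem_filter, mem_Ioo, ← abs_lt, and_comm, ← Int.cast_abs]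
  norm_cast

/-- A block is dominated by an average of exponential sums. The weight gains `bD / (2 ^ i M)` from
an integration by parts when `2 ^ i` exceeds `bD / M`. -/
theorem exists_norm_blockSum_le {ψ : ℝ → ℂ} (hψ : ContDiff ℝ 1 ψ) (hψc : HasCompactSupport ψ)
    {C₀ R : ℝ} (hC₀ : ∀ x, ‖ψ x‖ ≤ C₀) (hC₁ : ∀ x, ‖deriv ψ x‖ ≤ C₀)
    (hR : ∀ x, R < |x| → ψ x = 0) (hR' : ∀ x, R < |x| → deriv ψ x = 0)
    {M L m₀ D W : ℝ} (hM : 0 < M) (hD : 0 < D) (hW : 0 ≤ W) (hm₀ : |m₀| + R * M ≤ W * M)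
    {b g : ℕ} (hb : 0 < b) (a : ℕ → ℂ) (i : ℕ) :
    ∃ w : ℤ → ℂ, (∀ h ∈ freqBlock i, ‖w h‖ ≤ 1) ∧ ∀ d : ℕ, Nat.gcd b d = g → D * g < d →
      (d : ℝ) ≤ 2 * D * g → ∀ ν : ℕ, ‖blockSum ψ M L m₀ a b i d ν‖ ≤
        C₀ * min 1 (b * D / M / 2 ^ i) * ∫ t in (-(W * M / (b * D)))..(W * M / (b * D)),
          ‖blockPoly ((dyadic L).filter (fun l => b ∣ l)) a w b i t (ν / (d / g : ℕ))‖ := by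
  have hbR : (0 : ℝ) < b := by exact_mod_cast hb
  have hC₀' : 0 ≤ C₀ := (norm_nonneg _).trans (hC₀ 0)
  have hH : (0 : ℝ) < 2 ^ i := by positivity
  have ht₀ : 0 ≤ W * M / (b * D) := by positivity
  have hs : |m₀ / M| + R ≤ W := by
    rw [abs_div, abs_of_pos hM]
    have : |m₀| / M + R = (|m₀| + R * M) / M := by field_simp
    rw [this, div_le_iff₀ hM]
    exact hm₀
  -- basic facts on the modulus
  have hmod : ∀ d : ℕ, Nat.gcd b d = g → D * g < d → (d : ℝ) ≤ 2 * D * g →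
      Nat.lcm b d = b * (d / g) ∧ D < (d / g : ℕ) ∧ ((d / g : ℕ) : ℝ) ≤ 2 * D := by
    intro d hd h1 h2
    have hg : 0 < g := by rw [← hd]; exact Nat.gcd_pos_of_pos_left _ hb
    have hgR : (0 : ℝ) < g := by exact_mod_cast hg
    have h3 : g * (d / g) = d := Nat.mul_div_cancel' (by rw [← hd]; exact Nat.gcd_dvd_right b d)
    have h4 : (g : ℝ) * (d / g : ℕ) = d := by exact_mod_cast h3
    refine ⟨lcm_eq_mul_div hd, ?_, ?_⟩
    · refine lt_of_mul_lt_mul_left ?_ hgR.le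
      rw [h4]; linarith
    · refine le_of_mul_le_mul_left ?_ hgR
      rw [h4]; linarith
  have hκ : ∀ d : ℕ, Nat.gcd b d = g → D * g < d → (d : ℝ) ≤ 2 * D * g →
      b * D / M ≤ ((Nat.lcm b d : ℕ) : ℝ) / M ∧ ((Nat.lcm b d : ℕ) : ℝ) / M ≤ 2 * (b * D / M) := by
    intro d hd h1 h2
    obtain ⟨h3, h4, h5⟩ := hmod d hd h1 h2
    rw [h3]
    push_cast
    constructor
    · gcongr
    · rw [← mul_div_assoc]
      have : (b : ℝ) * (d / g : ℕ) ≤ 2 * (b * D) := by nlinarith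
      gcongr
  have hκ0 : (0 : ℝ) < b * D / M := by positivity
  have hfreq : ∀ d : ℕ, Nat.gcd b d = g → D * g < d → (d : ℝ) ≤ 2 * D * g →
      ∀ (ν l : ℕ) (h : ℤ), b ∣ l → (h : ℝ) * ((ν * l : ℝ) / (Nat.lcm b d : ℕ)) =
        h * ((l / b : ℕ) * (ν / (d / g : ℕ))) := by
    intro d hd h1 h2 ν l h hbl
    obtain ⟨h3, h4, h5⟩ := hmod d hd h1 h2
    obtain ⟨l', rfl⟩ := hbl
    rw [h3, Nat.mul_div_cancel_left _ hb]
    have : (0 : ℝ) < (d / g : ℕ) := hD.trans h4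
    push_cast
    field_simp
  have ht₁ : ∀ d : ℕ, Nat.gcd b d = g → D * g < d → (d : ℝ) ≤ 2 * D * g →
      |m₀ / M| + R ≤ ((Nat.lcm b d : ℕ) : ℝ) / M * (W * M / (b * D)) := by
    intro d hd h1 h2
    calc _ ≤ W := hs
      _ = b * D / M * (W * M / (b * D)) := by field_simp
      _ ≤ _ := mul_le_mul_of_nonneg_right (hκ d hd h1 h2).1 ht₀
  -- Here D is the size of d/g, so κ ≍ bD/M. Up to that frequency there is nothing to gain and `w`
  -- is constant.
  rcases le_or_gt ((2 : ℝ) ^ i) (b * D / M) with hcase | hcase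
  · refine ⟨fun _ => 1, fun _ _ => by simp, fun d hd h1 h2 ν => ?_⟩
    have hk := hκ0.trans_le (hκ d hd h1 h2).1
    have h3 : blockSum ψ M L m₀ a b i d ν = ∫ t, ψ (((Nat.lcm b d : ℕ) : ℝ) / M * t - m₀ / M) *
        blockPoly ((dyadic L).filter (fun l => b ∣ l)) a (fun _ => 1) b i t (ν / (d / g : ℕ)) := by
      rw [← sum_pcoef_eq_integral hψ.continuous hψc hk.ne', blockSum]
      refine sum_congr rfl fun l hl => ?_
      congr 1
      refine sum_congr rfl fun h _ => ?_
      rw [hfreq d hd h1 h2 ν l h (mem_filter.mp hl).2, one_mul]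
    rw [h3, min_eq_left ((one_le_div₀ hH).mpr hcase), mul_one]
    exact norm_integral_mul_le hψ.continuous (continuous_blockPoly _ _ _ _ _ _) hC₀ hR hk
      (ht₁ d hd h1 h2) ht₀
  -- The factor κ/(2πih) from integration by parts is split as κ/(2·2^i) times `w h`. The first is
  -- at most bD/(2^i M) because κ ≤ 2bD/M; the second is bounded by 1 because |h| ≥ 2^i, and is free
  -- of d.
  · refine ⟨fun h => 2 * 2 ^ i / (2 * Real.pi * Complex.I * h), fun h hh => ?_,
      fun d hd h1 h2 ν => ?_⟩
    · have hh' := (mem_freqBlock.mp hh).1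
      have : ‖(2 * Real.pi * Complex.I * h : ℂ)‖ = 2 * Real.pi * |(h : ℝ)| := by
        simp [abs_of_pos Real.pi_pos]
      rw [norm_div, this, div_le_one (by have := Real.pi_pos; nlinarith)]
      simp only [norm_mul, Complex.norm_ofNat, norm_pow]
      nlinarith [Real.pi_gt_three]
    · have hk := hκ0.trans_le (hκ d hd h1 h2).1
      have hdc : Continuous (deriv ψ) := hψ.continuous_deriv le_rfl
      have h3 : blockSum ψ M L m₀ a b i d ν = ((((Nat.lcm b d : ℕ) : ℝ) / M / (2 * 2 ^ i) : ℝ) : ℂ) *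
          ∫ t, deriv ψ (((Nat.lcm b d : ℕ) : ℝ) / M * t - m₀ / M) *
          blockPoly ((dyadic L).filter (fun l => b ∣ l)) a
            (fun h => 2 * 2 ^ i / (2 * Real.pi * Complex.I * h)) b i t (ν / (d / g : ℕ)) := by
        rw [← sum_pcoef_eq_integral hdc hψc.deriv hk.ne', blockSum, mul_sum]
        refine sum_congr rfl fun l hl => ?_
        rw [mul_left_comm]
        congr 1
        rw [mul_sum]
        refine sum_congr rfl fun h hh => ?_
        have hh0 : h ≠ 0 := by
          rintro rfl
          have := (mem_freqBlock.mp hh).1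
          simp at this
          linarith
        rw [hfreq d hd h1 h2 ν l h (mem_filter.mp hl).2, pcoef_eq_deriv hψ hψc hk.ne' _ hh0]
        have hpi : (Real.pi : ℂ) ≠ 0 := by exact_mod_cast Real.pi_ne_zero
        have hhc : (h : ℂ) ≠ 0 := by exact_mod_cast hh0
        push_cast
        field_simp
      have hlt : b * D / M / 2 ^ i ≤ 1 := (div_le_one hH).mpr hcase.le
      have hle : ((Nat.lcm b d : ℕ) : ℝ) / M / (2 * 2 ^ i) ≤ b * D / M / 2 ^ i := by
        rw [div_le_div_iff₀ (by positivity) hH]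
        have := (hκ d hd h1 h2).2
        nlinarith
      rw [h3, min_eq_right hlt, norm_mul, Complex.norm_real, Real.norm_of_nonneg (by positivity),
        mul_comm C₀, mul_assoc (b * D / M / 2 ^ i)]
      refine mul_le_mul hle (norm_integral_mul_le hdc (continuous_blockPoly _ _ _ _ _ _) hC₁ hR' hk
        (ht₁ d hd h1 h2) ht₀) (norm_nonneg _) (by positivity)

/-! ### Second moments of the coefficients. -/

theorem sum_norm_sum_fiber_sq_le {ι : Type*} [DecidableEq ι] (P : Finset ι) (f : ι → ℤ) {w : ι → ℂ}
    (hw : ∀ p ∈ P, ‖w p‖ ≤ 1) :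
    ∑ n ∈ P.image f, ‖∑ p ∈ P.filter (fun p => f p = n), w p‖ ^ 2 ≤
      ∑ p ∈ P, ((P.filter (fun p' => f p' = f p)).card : ℝ) := by
  rw [← sum_fiberwise_of_maps_to (s := P) (t := P.image f) (g := f)
    (fun p hp => mem_image_of_mem f hp)]
  refine sum_le_sum fun n _ => ?_
  have h1 : ‖∑ p ∈ P.filter (fun p => f p = n), w p‖ ≤ (P.filter (fun p => f p = n)).card := by
    refine (norm_sum_le_of_le _ fun p hp => hw p (mem_filter.mp hp).1).trans ?_
    simp
  have h2 : ∑ p ∈ P.filter (fun p => f p = n), ((P.filter (fun p' => f p' = f p)).card : ℝ) =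
      ((P.filter (fun p => f p = n)).card : ℝ) ^ 2 := by
    rw [sum_congr rfl (g := fun _ => ((P.filter (fun p' => f p' = n)).card : ℝ))
      (fun p hp => by rw [(mem_filter.mp hp).2]), sum_const, nsmul_eq_mul, sq]
  rw [h2]
  gcongr

theorem freqBlock_ne_zero {i : ℕ} {h : ℤ} (hh : h ∈ freqBlock i) : h ≠ 0 := by
  rintro rfl
  have h1 := (mem_freqBlock.mp hh).1
  have h2 : (0 : ℝ) < 2 ^ i := by positivity
  simp at h1
  linarith

/-- A pair with a given nonzero product n = h(l/b) is determined by the divisor l/b of |n|, so there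
are at most τ(|n|) ≤ τ(l/b)τ(|h|) of them. -/
theorem sum_card_fiber_le (Λ : Finset ℕ) {b : ℕ} (hΛ : ∀ l ∈ Λ, b ∣ l ∧ 0 < l) (i : ℕ) :
    ∑ p ∈ Λ ×ˢ freqBlock i, (((Λ ×ˢ freqBlock i).filter
      (fun p' => p'.2 * ((p'.1 / b : ℕ) : ℤ) = p.2 * ((p.1 / b : ℕ) : ℤ))).card : ℝ) ≤
      (∑ l ∈ Λ, ((l / b).divisors.card : ℝ)) * ∑ h ∈ freqBlock i, (h.natAbs.divisors.card : ℝ) := by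
  have hpos : ∀ l ∈ Λ, 0 < l / b := fun l hl => by
    obtain ⟨h1, h2⟩ := hΛ l hl
    exact Nat.div_pos (Nat.le_of_dvd h2 h1) (Nat.pos_of_dvd_of_pos h1 h2)
  rw [sum_mul_sum, ← sum_product']
  refine sum_le_sum fun p hp => ?_
  rw [mem_product] at hp
  rw [← Nat.cast_mul, Nat.cast_le]
  refine le_trans ?_ (card_divisors_mul_le _ _)
  refine card_le_card_of_injOn (fun p' => p'.1 / b) ?_ ?_
  · intro p' hp'
    rw [mem_coe, mem_filter, mem_product] at hp'
    rw [mem_coe, Nat.mem_divisors]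
    refine ⟨?_, ?_⟩
    · refine ⟨p'.2.natAbs, ?_⟩
      have := congrArg Int.natAbs hp'.2
      rw [Int.natAbs_mul, Int.natAbs_mul, Int.natAbs_natCast, Int.natAbs_natCast] at this
      rw [mul_comm, ← this, mul_comm]
    · have h1 := hpos _ hp.1
      have h2 := freqBlock_ne_zero hp.2
      have h3 : 0 < p.2.natAbs := Int.natAbs_pos.mpr h2
      positivity
  · intro p' hp' p'' hp'' heq
    rw [mem_coe, mem_filter, mem_product] at hp' hp''
    simp only at heq
    have h1 : p'.1 = p''.1 := by
      rw [← Nat.div_mul_cancel (hΛ _ hp'.1.1).1, ← Nat.div_mul_cancel (hΛ _ hp''.1.1).1, heq]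
    have h2 : p'.2 = p''.2 := by
      have h3 := hp'.2.trans hp''.2.symm
      rw [heq] at h3
      have h4 := hpos _ hp''.1.1
      exact mul_right_cancel₀ (by positivity) h3
    exact Prod.ext h1 h2

theorem sum_freqBlock_divisors_le {i : ℕ} {W : ℝ} (hW : 1 + Real.log ((2 ^ (i + 1) : ℕ) : ℝ) ≤ W) :
    ∑ h ∈ freqBlock i, (h.natAbs.divisors.card : ℝ) ≤ 4 * 2 ^ i * W ^ 2 := by
  have h1 : ∀ h ∈ freqBlock i, h.natAbs ∈ Icc 1 (2 ^ (i + 1)) := by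
    intro h hh
    have h2 := freqBlock_ne_zero hh
    rw [freqBlock, mem_filter, mem_Ioo] at hh
    rw [mem_Icc]
    omega
  rw [← sum_fiberwise_of_maps_to h1]
  have h3 : ∀ n ∈ Icc 1 (2 ^ (i + 1)), ∑ h ∈ (freqBlock i).filter (fun h => h.natAbs = n),
      (h.natAbs.divisors.card : ℝ) ≤ 2 * (n.divisors.card : ℝ) := by
    intro n _
    rw [sum_congr rfl (g := fun _ => (n.divisors.card : ℝ))
      (fun h hh => by rw [(mem_filter.mp hh).2]), sum_const, nsmul_eq_mul]
    have h4 : ((freqBlock i).filter (fun h => h.natAbs = n)).card ≤ 2 := by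
      refine (card_le_card (t := {(n : ℤ), -(n : ℤ)}) fun h hh => ?_).trans card_le_two
      rw [mem_filter] at hh
      simp only [mem_insert, mem_singleton]
      omega
    gcongr
    exact_mod_cast h4
  refine (sum_le_sum h3).trans ?_
  rw [← mul_sum]
  have h5 := sum_card_divisors_pow_le 1 (2 ^ (i + 1))
  simp only [pow_one] at h5
  have h0 : 0 ≤ 1 + Real.log ((2 ^ (i + 1) : ℕ) : ℝ) := by
    have := Real.log_natCast_nonneg (2 ^ (i + 1)); linarith
  calc 2 * ∑ n ∈ Icc 1 (2 ^ (i + 1)), (n.divisors.card : ℝ)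
      ≤ 2 * (((2 ^ (i + 1) : ℕ) : ℝ) * (1 + Real.log ((2 ^ (i + 1) : ℕ) : ℝ)) ^ 2) := by linarith
    _ ≤ 2 * (((2 ^ (i + 1) : ℕ) : ℝ) * W ^ 2) := by gcongr
    _ = _ := by push_cast; ring

/-- The `k`-th powers in the dyadic range of `L` that are divisible by `b`. -/
def powersDyadic (k : ℕ) (L : ℝ) (b : ℕ) : Finset ℕ :=
  open Classical in (dyadic L).filter (fun l => b ∣ l ∧ ∃ n : ℕ, l = n ^ k)

theorem mem_powersDyadic {k : ℕ} {L : ℝ} {b l : ℕ} :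
    l ∈ powersDyadic k L b ↔ l ∈ dyadic L ∧ b ∣ l ∧ ∃ n : ℕ, l = n ^ k := by
  classical
  unfold powersDyadic
  simp only [mem_filter]

/-- This is where a full factor 1/b is saved: a squarefree b dividing n^k divides n, so l = (bm)^k
with m ≤ (2L)^(1/k)/b. -/
theorem sum_powersDyadic_le {k : ℕ} (hk : 1 ≤ k) {L W : ℝ} (hL : 0 ≤ L) {b : ℕ} (hb : Squarefree b)
    (hW : 1 + Real.log (2 * L + 2) ≤ W) :
    ∑ l ∈ powersDyadic k L b, ((l / b).divisors.card : ℝ) ≤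
      (b.divisors.card : ℝ) ^ k * ((2 * L) ^ (1 / (k : ℝ)) / b) * W ^ 2 ^ k := by
  have hb0 : 0 < b := Nat.pos_of_ne_zero hb.ne_zero
  have hbR : (0 : ℝ) < b := by exact_mod_cast hb0
  have hkR : (0 : ℝ) < k := by exact_mod_cast hk
  set X : ℝ := (2 * L) ^ (1 / (k : ℝ)) with hX
  have hX0 : 0 ≤ X := by positivity
  have hsub : powersDyadic k L b ⊆ (Icc 1 ⌊X / b⌋₊).image (fun n => (b * n) ^ k) := by
    intro l hl
    rw [mem_powersDyadic, dyadic, mem_Ioc] at hl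
    obtain ⟨⟨hl1, hl2⟩, hbl, n, rfl⟩ := hl
    obtain ⟨m, rfl⟩ := (hb.dvd_pow_iff_dvd (by omega)).mp hbl
    rw [mem_image]
    refine ⟨m, ?_, rfl⟩
    rw [mem_Icc]
    constructor
    · rcases Nat.eq_zero_or_pos m with h | h
      · subst h
        rw [mul_zero, zero_pow (by omega)] at hl1
        omega
      · exact h
    · apply Nat.le_floor
      rw [le_div_iff₀ hbR]
      have h1 : (((b * m) ^ k : ℕ) : ℝ) ≤ 2 * L :=
        (Nat.le_floor_iff (by positivity)).mp hl2
      push_cast at h1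
      have h2 : ((b * m : ℝ) ^ k) ^ (1 / (k : ℝ)) ≤ (2 * L) ^ (1 / (k : ℝ)) := by gcongr
      rw [one_div, Real.pow_rpow_inv_natCast (by positivity) (by omega), ← one_div] at h2
      rw [mul_comm]
      exact h2
  refine (sum_le_sum_of_subset_of_nonneg hsub fun _ _ _ => by positivity).trans ?_
  rw [sum_image]
  · have h1 : ∀ n ∈ Icc 1 ⌊X / b⌋₊, (((b * n) ^ k / b).divisors.card : ℝ) ≤
        (b.divisors.card : ℝ) ^ k * (n.divisors.card : ℝ) ^ k := by
      intro n hn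
      rw [mem_Icc] at hn
      have h2 : ((b * n) ^ k / b).divisors ⊆ ((b * n) ^ k).divisors :=
        Nat.divisors_subset_of_dvd (pow_ne_zero _ (by have := hn.1; positivity))
          (Nat.div_dvd_of_dvd ((dvd_mul_right b n).trans (dvd_pow_self _ (by omega))))
      rw [← mul_pow]
      have h3 : ((b * n) ^ k / b).divisors.card ≤ (b.divisors.card * n.divisors.card) ^ k :=
        (card_le_card h2).trans ((card_divisors_pow_le _ _).trans
          (Nat.pow_le_pow_left (card_divisors_mul_le _ _) _))
      exact_mod_cast h3
    refine (sum_le_sum h1).trans ?_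
    rw [← mul_sum, mul_assoc]
    refine mul_le_mul_of_nonneg_left ?_ (by positivity)
    refine (sum_card_divisors_pow_le k _).trans ?_
    have h4 : ((⌊X / b⌋₊ : ℕ) : ℝ) ≤ X / b := Nat.floor_le (by positivity)
    have h5 : X / b ≤ 2 * L + 2 := by
      have hb1 : (1 : ℝ) ≤ b := by exact_mod_cast hb0
      have h6 : X ≤ (2 * L + 2) ^ (1 / (k : ℝ)) := by
        rw [hX]; gcongr; linarith
      have h7 : (2 * L + 2) ^ (1 / (k : ℝ)) ≤ (2 * L + 2) ^ (1 : ℝ) := by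
        apply Real.rpow_le_rpow_of_exponent_le (by linarith)
        rw [div_le_one hkR]; exact_mod_cast hk
      rw [Real.rpow_one] at h7
      exact (div_le_self hX0 hb1).trans (h6.trans h7)
    have h8 : Real.log (⌊X / b⌋₊ : ℕ) ≤ Real.log (2 * L + 2) := by
      rcases Nat.eq_zero_or_pos ⌊X / b⌋₊ with h | h
      · rw [h]; simp; exact Real.log_nonneg (by linarith)
      · exact Real.log_le_log (by exact_mod_cast h) (h4.trans h5)
    have h9 := Real.log_natCast_nonneg ⌊X / b⌋₊
    gcongr
    linarith
  · intro x _ y _ hxy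
    have h1 : b * x = b * y := Nat.pow_left_injective (by omega : k ≠ 0) hxy
    exact Nat.eq_of_mul_eq_mul_left hb0 h1

/-- The exponent 2K + 1 collects τ^(2K) from |α|² and one τ from the number of roots; writing d = gq
gives the density 1/g. -/
theorem sum_norm_sq_mul_rho_le {A D W : ℝ} {K g : ℕ} (hA : 0 < A) (hD : 0 ≤ D) (hg : 0 < g)
    {α : ℕ → ℂ} (hα : DivisorBoundedBy A K α) (hW : 1 + Real.log (2 * D + 2) ≤ W) (T : Finset ℕ)
    (hT : T ⊆ (dyadic D).filter (fun d => g ∣ d)) :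
    ∑ d ∈ T, ∑ _ν ∈ rootsNegOne d, ‖α d‖ ^ 2 ≤
      3 * A ^ 2 * (g.divisors.card : ℝ) ^ (2 * K + 1) * (2 * D / g) *
        W ^ (2 * K + 2 ^ (2 * K + 1)) := by
  have hgR : (0 : ℝ) < g := by exact_mod_cast hg
  have hW0 : 0 ≤ W := by
    have := Real.log_nonneg (by linarith : 1 ≤ 2 * D + 2)
    linarith
  have h1 : ∀ d ∈ (dyadic D).filter (fun d => g ∣ d), ∑ _ν ∈ rootsNegOne d, ‖α d‖ ^ 2 ≤
      3 * A ^ 2 * W ^ (2 * K) * (d.divisors.card : ℝ) ^ (2 * K + 1) := by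
    intro d hd
    rw [mem_filter, mem_dyadic hD] at hd
    have hd0 : (0 : ℝ) < d := hD.trans_lt hd.1.1
    have hd1 : 1 ≤ d := by exact_mod_cast hd0
    rw [sum_const, nsmul_eq_mul]
    have h2 : ((rootsNegOne d).card : ℝ) ≤ 3 * d.divisors.card := by
      exact_mod_cast card_rootsNegOne_le d
    have h3 : Real.log ((d : ℝ) + 2) ≤ W := by
      have : Real.log ((d : ℝ) + 2) ≤ Real.log (2 * D + 2) :=
        Real.log_le_log (by linarith) (by linarith [hd.1.2])
      linarith
    have h4 : 0 ≤ Real.log ((d : ℝ) + 2) := Real.log_nonneg (by linarith)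
    have h5 : ‖α d‖ ≤ A * (d.divisors.card : ℝ) ^ K * W ^ K := by
      refine (hα d hd1).trans ?_
      gcongr
    calc _ ≤ (3 * d.divisors.card : ℝ) * (A * (d.divisors.card : ℝ) ^ K * W ^ K) ^ 2 := by
          gcongr
      _ = _ := by ring
  refine (sum_le_sum_of_subset_of_nonneg hT fun _ _ _ => by positivity).trans ?_
  refine (sum_le_sum h1).trans ?_
  rw [← mul_sum]
  have hsub : (dyadic D).filter (fun d => g ∣ d) ⊆ (Icc 1 ⌊2 * D / g⌋₊).image (fun q => g * q) := by
    intro d hd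
    rw [mem_filter, mem_dyadic hD] at hd
    obtain ⟨⟨hd1, hd2⟩, q, rfl⟩ := hd
    rw [mem_image]
    refine ⟨q, ?_, rfl⟩
    rw [mem_Icc]
    constructor
    · rcases Nat.eq_zero_or_pos q with h | h
      · subst h; simp at hd1; linarith
      · exact h
    · apply Nat.le_floor
      rw [le_div_iff₀ hgR]
      push_cast at hd2
      linarith
  have h6 : ∑ d ∈ (dyadic D).filter (fun d => g ∣ d), (d.divisors.card : ℝ) ^ (2 * K + 1) ≤
      (g.divisors.card : ℝ) ^ (2 * K + 1) * (2 * D / g * W ^ 2 ^ (2 * K + 1)) := by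
    refine (sum_le_sum_of_subset_of_nonneg hsub fun _ _ _ => by positivity).trans ?_
    rw [sum_image fun x _ y _ hxy => Nat.eq_of_mul_eq_mul_left hg hxy]
    have h7 : ∀ q ∈ Icc 1 ⌊2 * D / g⌋₊, ((g * q).divisors.card : ℝ) ^ (2 * K + 1) ≤
        (g.divisors.card : ℝ) ^ (2 * K + 1) * (q.divisors.card : ℝ) ^ (2 * K + 1) := by
      intro q _
      rw [← mul_pow]
      gcongr
      exact_mod_cast card_divisors_mul_le g q
    refine (sum_le_sum h7).trans ?_
    rw [← mul_sum]
    refine mul_le_mul_of_nonneg_left ?_ (by positivity)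
    refine (sum_card_divisors_pow_le _ _).trans ?_
    have h4 : ((⌊2 * D / g⌋₊ : ℕ) : ℝ) ≤ 2 * D / g := Nat.floor_le (by positivity)
    have h5 : 2 * D / g ≤ 2 * D + 2 := by
      have hg1 : (1 : ℝ) ≤ g := by exact_mod_cast hg
      have := div_le_self (by positivity : 0 ≤ 2 * D) hg1
      linarith
    have h8 : Real.log (⌊2 * D / g⌋₊ : ℕ) ≤ Real.log (2 * D + 2) := by
      rcases Nat.eq_zero_or_pos ⌊2 * D / g⌋₊ with h | h
      · rw [h]; simp; exact Real.log_nonneg (by linarith)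
      · exact Real.log_le_log (by exact_mod_cast h) (h4.trans h5)
    have h9 := Real.log_natCast_nonneg ⌊2 * D / g⌋₊
    gcongr
    linarith
  calc _ ≤ 3 * A ^ 2 * W ^ (2 * K) * ((g.divisors.card : ℝ) ^ (2 * K + 1) *
        (2 * D / g * W ^ 2 ^ (2 * K + 1))) := by gcongr
    _ = _ := by rw [pow_add]; ring

theorem blockPoly_eq_trigPoly {k : ℕ} {L : ℝ} {a : ℕ → ℂ}
    (ha : SupportedOnPowers k a) (w : ℤ → ℂ) (b i : ℕ) (t x : ℝ) :
    blockPoly ((dyadic L).filter (fun l => b ∣ l)) a w b i t x =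
      trigPoly ((powersDyadic k L b ×ˢ freqBlock i).image
        (fun p => p.2 * ((p.1 / b : ℕ) : ℤ)))
        (fun n => ∑ p ∈ (powersDyadic k L b ×ˢ freqBlock i).filter
          (fun p => p.2 * ((p.1 / b : ℕ) : ℤ) = n), a p.1 * (w p.2 * ex (-(p.2 * t)))) x := by
  have h1 : blockPoly ((dyadic L).filter (fun l => b ∣ l)) a w b i t x =
      ∑ p ∈ powersDyadic k L b ×ˢ freqBlock i, a p.1 * (w p.2 * ex (-(p.2 * t))) *
        ex ((p.2 * ((p.1 / b : ℕ) : ℤ) : ℤ) * x) := by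
    rw [sum_product, blockPoly]
    have h2 : powersDyadic k L b ⊆ (dyadic L).filter (fun l => b ∣ l) := by
      intro l hl
      rw [mem_powersDyadic] at hl
      exact mem_filter.mpr ⟨hl.1, hl.2.1⟩
    rw [← sum_subset h2]
    · refine sum_congr rfl fun l _ => ?_
      rw [mul_sum]
      refine sum_congr rfl fun h _ => ?_
      rw [mul_assoc (a l)]
      congr 3
      rw [Int.cast_mul, Int.cast_natCast]
      ring
    · intro l hl hl'
      have h3 : ¬ ∃ n : ℕ, l = n ^ k := fun h => hl' (by
        rw [mem_filter] at hl
        rw [mem_powersDyadic]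
        exact ⟨hl.1, hl.2, h⟩)
      have h4 := ha l
      rw [Set.indicator_of_notMem (by exact h3), norm_le_zero_iff] at h4
      rw [h4, zero_mul]
  rw [h1, trigPoly]
  rw [← sum_fiberwise_of_maps_to (t := (powersDyadic k L b ×ˢ freqBlock i).image
    (fun p => p.2 * ((p.1 / b : ℕ) : ℤ))) (g := fun p => p.2 * ((p.1 / b : ℕ) : ℤ))
    (fun p hp => mem_image_of_mem _ hp)]
  refine sum_congr rfl fun n _ => ?_
  rw [sum_mul]
  refine sum_congr rfl fun p hp => ?_
  rw [(mem_filter.mp hp).2]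

/-! ### The estimate for one block. -/

/-- Cauchy–Schwarz over the pairs (d, ν): the first root is the second moment of α, the second is
the large sieve with denominators of size D/g and frequencies up to 2^(i+1)·2L/b. -/
theorem sum_norm_blockPoly_le {k : ℕ} (hk : 1 ≤ k) {A D L W : ℝ} {K g b : ℕ} (hA : 0 < A)
    (hD : 0 < D) (hL : 0 < L) (hg : 0 < g) (hb : Squarefree b) {a α : ℕ → ℂ}
    (ha : SupportedOnPowers k a) (hα : DivisorBoundedBy A K α)
    (hWD : 1 + Real.log (2 * D + 2) ≤ W) (hWL : 1 + Real.log (2 * L + 2) ≤ W) {i : ℕ}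
    (hWi : 1 + Real.log ((2 ^ (i + 1) : ℕ) : ℝ) ≤ W) {w : ℤ → ℂ}
    (hw : ∀ h ∈ freqBlock i, ‖w h‖ ≤ 1) (t : ℝ) :
    ∑ d ∈ (dyadic D).filter (fun d => Nat.gcd b d = g), ‖α d‖ * ∑ ν ∈ rootsNegOne d,
      ‖blockPoly ((dyadic L).filter (fun l => b ∣ l)) a w b i t (ν / (d / g : ℕ))‖ ≤
    Real.sqrt (3 * A ^ 2 * (g.divisors.card : ℝ) ^ (2 * K + 1) * (2 * D / g) *
        W ^ (2 * K + 2 ^ (2 * K + 1))) *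
      Real.sqrt (64 * g * (D / g + 4 * 2 ^ i * L / b) * (((b.divisors.card : ℝ) ^ k *
        ((2 * L) ^ (1 / (k : ℝ)) / b) * W ^ 2 ^ k) * (4 * 2 ^ i * W ^ 2))) := by
  have hgR : (0 : ℝ) < g := by exact_mod_cast hg
  have hb0 : 0 < b := Nat.pos_of_ne_zero hb.ne_zero
  have hbR : (0 : ℝ) < b := by exact_mod_cast hb0
  have hW0 : 0 ≤ W := by
    have := Real.log_nonneg (by linarith : 1 ≤ 2 * D + 2)
    linarith
  set T := (dyadic D).filter (fun d => Nat.gcd b d = g) with hT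
  have hTD : ∀ d ∈ T, g ∣ d ∧ D < d ∧ (d : ℝ) ≤ 2 * D := by
    intro d hd
    rw [hT, mem_filter, mem_dyadic hD.le] at hd
    exact ⟨by rw [← hd.2]; exact Nat.gcd_dvd_right b d, hd.1⟩
  have ha1 : ∀ l, ‖a l‖ ≤ 1 := fun l => (ha l).trans
    (Set.indicator_le_self' (fun _ _ => zero_le_one) l)
  have hΛ : ∀ l ∈ powersDyadic k L b, b ∣ l ∧ 0 < l ∧ (l : ℝ) ≤ 2 * L := by
    intro l hl
    rw [mem_powersDyadic, mem_dyadic hL.le] at hl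
    exact ⟨hl.2.1, by exact_mod_cast hL.trans hl.1.1, hl.1.2⟩
  set S := (powersDyadic k L b ×ˢ freqBlock i).image (fun p => p.2 * ((p.1 / b : ℕ) : ℤ)) with hS
  have hSN : ∀ n ∈ S, |(n : ℝ)| ≤ 4 * 2 ^ i * L / b := by
    intro n hn
    rw [hS, mem_image] at hn
    obtain ⟨p, hp, rfl⟩ := hn
    rw [mem_product] at hp
    have h1 := (mem_freqBlock.mp hp.2).2
    obtain ⟨h2, h3, h4⟩ := hΛ _ hp.1
    rw [Int.cast_mul, Int.cast_natCast, abs_mul, Nat.abs_cast, Nat.cast_div h2 hbR.ne']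
    calc |(p.2 : ℝ)| * ((p.1 : ℝ) / b) ≤ 2 ^ (i + 1) * (2 * L / b) := by gcongr
      _ = _ := by rw [pow_succ]; ring
  set c : ℤ → ℂ := fun n => ∑ p ∈ (powersDyadic k L b ×ˢ freqBlock i).filter
    (fun p => p.2 * ((p.1 / b : ℕ) : ℤ) = n), a p.1 * (w p.2 * ex (-(p.2 * t))) with hc
  have hcS : ∑ n ∈ S, ‖c n‖ ^ 2 ≤ ((b.divisors.card : ℝ) ^ k *
      ((2 * L) ^ (1 / (k : ℝ)) / b) * W ^ 2 ^ k) * (4 * 2 ^ i * W ^ 2) := by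
    refine (sum_norm_sum_fiber_sq_le _ _ fun p hp => ?_).trans
      ((sum_card_fiber_le _ (fun l hl => ⟨(hΛ l hl).1, (hΛ l hl).2.1⟩) i).trans ?_)
    · rw [mem_product] at hp
      rw [norm_mul, norm_mul, norm_ex, mul_one]
      exact mul_le_one₀ (ha1 _) (norm_nonneg _) (hw _ hp.2)
    · refine mul_le_mul (sum_powersDyadic_le hk hL.le hb hWL) (sum_freqBlock_divisors_le hWi)
        (sum_nonneg fun _ _ => Nat.cast_nonneg _)
        (mul_nonneg (by positivity) (pow_nonneg hW0 _))
  have hLS := large_sieve_roots (D := D / g) (N := 4 * 2 ^ i * L / b) (g := g) (by positivity)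
    (by positivity) T (fun d hd => by
      obtain ⟨h1, h2, h3⟩ := hTD d hd
      refine ⟨h1, ?_, ?_⟩
      · rw [div_mul_cancel₀ _ hgR.ne']; exact h2
      · rw [mul_assoc, div_mul_cancel₀ _ hgR.ne']; exact h3) S c hSN
  have hα2 := sum_norm_sq_mul_rho_le hA hD.le hg hα hWD T (fun d hd => by
    rw [mem_filter]
    exact ⟨(mem_filter.mp hd).1, (hTD d hd).1⟩)
  have heq : ∀ x, blockPoly ((dyadic L).filter (fun l => b ∣ l)) a w b i t x = trigPoly S c x :=
    fun x => blockPoly_eq_trigPoly ha w b i t x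
  simp only [heq]
  calc ∑ d ∈ T, ‖α d‖ * ∑ ν ∈ rootsNegOne d, ‖trigPoly S c (ν / (d / g : ℕ))‖
      = ∑ p ∈ T.sigma rootsNegOne, ‖α p.1‖ * ‖trigPoly S c (p.2 / (p.1 / g : ℕ))‖ := by
        rw [sum_sigma]
        exact sum_congr rfl fun d _ => mul_sum _ _ _
    _ ≤ Real.sqrt (∑ p ∈ T.sigma rootsNegOne, ‖α p.1‖ ^ 2) *
        Real.sqrt (∑ p ∈ T.sigma rootsNegOne, ‖trigPoly S c (p.2 / (p.1 / g : ℕ))‖ ^ 2) :=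
        Real.sum_mul_le_sqrt_mul_sqrt _ _ _
    _ ≤ _ := by
        rw [sum_sigma, sum_sigma]
        refine mul_le_mul (Real.sqrt_le_sqrt hα2) (Real.sqrt_le_sqrt (hLS.trans ?_))
          (Real.sqrt_nonneg _) (Real.sqrt_nonneg _)
        exact mul_le_mul_of_nonneg_left hcS (by positivity)

theorem one_le_card_divisors {n : ℕ} (hn : n ≠ 0) : (1 : ℝ) ≤ n.divisors.card := by
  have : 0 < n.divisors.card := card_pos.mpr ⟨1, Nat.one_mem_divisors.mpr hn⟩
  exact_mod_cast this

/-- Let μ be the minimum and H = 2^i. From μ ≤ 1 and μH ≤ bD/(gM), both μ²H and μ²H² are controlled,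
so the bound is uniform in H; the powers of g cancel. The constant comes from 157² ≥ 24576 =
3·2·64·4·4·4. -/
theorem block_quantity_le {A D L M W X b g τb τg : ℝ} (hD : 0 < D) (hL : 0 < L)
    (hM : 0 < M) (hb : 0 < b) (hg : 0 < g) (hW : 1 ≤ W) (hX : 0 ≤ X) (hA : 0 < A)
    (hτg : 1 ≤ τg) (hτ : τg ≤ τb) (K k e₁ e₂ i : ℕ) :
    min 1 (b * (D / g) / M / 2 ^ i) * (2 * (W * M / (b * (D / g)))) *
      (Real.sqrt (3 * A ^ 2 * τg ^ (2 * K + 1) * (2 * D / g) * W ^ e₁) *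
      Real.sqrt (64 * g * (D / g + 4 * 2 ^ i * L / b) * ((τb ^ k *
        (X / b) * W ^ e₂) * (4 * 2 ^ i * W ^ 2)))) ≤
    157 * A * W ^ (4 + e₁ + e₂) * (τb ^ (2 * K + 1 + k) / b) * Real.sqrt (D * (M + L) * X) := by
  have hτb : 1 ≤ τb := hτg.trans hτ
  set H : ℝ := 2 ^ i with hH
  have hH0 : 0 < H := by positivity
  set μ := min 1 (b * (D / g) / M / H) with hμ
  have hμ0 : 0 ≤ μ := by rw [hμ]; positivity
  have hμ1 : μ ≤ 1 := min_le_left _ _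
  have hμH : μ * H ≤ b * (D / g) / M := by
    have := min_le_right 1 (b * (D / g) / M / H)
    rwa [← hμ, le_div_iff₀ hH0] at this
  have hkey : μ ^ 2 * (H * (D / g + 4 * H * L / b)) ≤ 4 * b * (D / g) ^ 2 * (M + L) / M ^ 2 := by
    have h1 : μ ^ 2 * H ≤ b * (D / g) / M := by
      calc μ ^ 2 * H = μ * (μ * H) := by ring
        _ ≤ 1 * (b * (D / g) / M) := by gcongr
        _ = _ := one_mul _
    have h2 : μ ^ 2 * H ^ 2 ≤ (b * (D / g) / M) ^ 2 := by
      rw [← mul_pow]; gcongr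
    calc μ ^ 2 * (H * (D / g + 4 * H * L / b))
        = (μ ^ 2 * H) * (D / g) + (μ ^ 2 * H ^ 2) * (4 * L / b) := by ring
      _ ≤ (b * (D / g) / M) * (D / g) + (b * (D / g) / M) ^ 2 * (4 * L / b) := by gcongr
      _ = b * (D / g) ^ 2 * (M + 4 * L) / M ^ 2 := by field_simp
      _ ≤ _ := by
        gcongr ?_ / _
        have : 0 ≤ b * (D / g) ^ 2 := by positivity
        nlinarith
  refine (sq_le_sq₀ (by positivity) (by positivity)).mp ?_
  have hsq : ∀ {x y u v : ℝ}, 0 ≤ u → 0 ≤ v →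
      (x * y * (√u * √v)) ^ 2 = x ^ 2 * y ^ 2 * (u * v) := by
    intro x y u v hu hv
    rw [mul_pow, mul_pow, mul_pow, Real.sq_sqrt hu, Real.sq_sqrt hv]
  rw [hsq (by positivity) (by positivity), mul_pow _ (√(D * (M + L) * X)),
    Real.sq_sqrt (by positivity)]
  have hW2 : W ^ (4 + e₁ + e₂) ≤ (W ^ (4 + e₁ + e₂)) ^ 2 :=
    le_self_pow₀ (one_le_pow₀ hW) two_ne_zero
  have hτ2 : τb ^ (2 * K + 1 + k) ≤ (τb ^ (2 * K + 1 + k)) ^ 2 :=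
    le_self_pow₀ (one_le_pow₀ hτb) two_ne_zero
  have hDg : 0 < D / g := by positivity
  calc μ ^ 2 * (2 * (W * M / (b * (D / g)))) ^ 2 *
        ((3 * A ^ 2 * τg ^ (2 * K + 1) * (2 * D / g) * W ^ e₁) *
        (64 * g * (D / g + 4 * H * L / b) * ((τb ^ k * (X / b) * W ^ e₂) * (4 * H * W ^ 2))))
      = (2 * (W * M / (b * (D / g)))) ^ 2 * (3 * A ^ 2 * τg ^ (2 * K + 1) * (2 * D / g) * W ^ e₁) *
        (64 * g * (τb ^ k * (X / b) * W ^ e₂) * (4 * W ^ 2)) *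
        (μ ^ 2 * (H * (D / g + 4 * H * L / b))) := by ring
    _ ≤ (2 * (W * M / (b * (D / g)))) ^ 2 * (3 * A ^ 2 * τb ^ (2 * K + 1) * (2 * D / g) * W ^ e₁) *
        (64 * g * (τb ^ k * (X / b) * W ^ e₂) * (4 * W ^ 2)) *
        (4 * b * (D / g) ^ 2 * (M + L) / M ^ 2) := by gcongr
    _ = 24576 * A ^ 2 * W ^ (4 + e₁ + e₂) * τb ^ (2 * K + 1 + k) / b ^ 2 * (D * (M + L) * X) := by
        rw [pow_add W, pow_add W, pow_add τb]
        field_simp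
        ring
    _ ≤ 157 ^ 2 * A ^ 2 * (W ^ (4 + e₁ + e₂)) ^ 2 * (τb ^ (2 * K + 1 + k)) ^ 2 / b ^ 2 *
        (D * (M + L) * X) := by
        gcongr
        norm_num
    _ = _ := by ring

theorem block_bound {ψ : ℝ → ℂ} (hψ : ContDiff ℝ 1 ψ) (hψc : HasCompactSupport ψ)
    {C₀ R : ℝ} (hC₀ : ∀ x, ‖ψ x‖ ≤ C₀) (hC₁ : ∀ x, ‖deriv ψ x‖ ≤ C₀)
    (hR : ∀ x, R < |x| → ψ x = 0) (hR' : ∀ x, R < |x| → deriv ψ x = 0)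
    {k : ℕ} (hk : 1 ≤ k) {A M D L m₀ W : ℝ} {K g b : ℕ} (hA : 0 < A) (hM : 0 < M)
    (hD : 0 < D) (hL : 0 < L) (hb : Squarefree b) (hgb : g ∣ b) {a α : ℕ → ℂ}
    (ha : SupportedOnPowers k a) (hα : DivisorBoundedBy A K α)
    (hm₀ : |m₀| + R * M ≤ W * M)
    (hWD : 1 + Real.log (2 * D + 2) ≤ W) (hWL : 1 + Real.log (2 * L + 2) ≤ W) {i : ℕ}
    (hWi : 1 + Real.log ((2 ^ (i + 1) : ℕ) : ℝ) ≤ W) :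
    ∑ d ∈ (dyadic D).filter (fun d => Nat.gcd b d = g), ‖α d‖ * ∑ ν ∈ rootsNegOne d,
      ‖blockSum ψ M L m₀ a b i d ν‖ ≤
    C₀ * (157 * A * W ^ (4 + (2 * K + 2 ^ (2 * K + 1)) + 2 ^ k) *
      ((b.divisors.card : ℝ) ^ (2 * K + 1 + k) / b) *
      Real.sqrt (D * (M + L) * (2 * L) ^ (1 / (k : ℝ)))) := by
  have hb0 : 0 < b := Nat.pos_of_ne_zero hb.ne_zero
  have hg : 0 < g := Nat.pos_of_dvd_of_pos hgb hb0
  have hgR : (0 : ℝ) < g := by exact_mod_cast hg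
  have hbR : (0 : ℝ) < b := by exact_mod_cast hb0
  have hC₀' : 0 ≤ C₀ := (norm_nonneg _).trans (hC₀ 0)
  have hW1 : 1 ≤ W := by
    have := Real.log_nonneg (by linarith : 1 ≤ 2 * D + 2)
    linarith
  obtain ⟨w, hw, hbd⟩ := exists_norm_blockSum_le (g := g) (L := L) hψ hψc hC₀ hC₁ hR hR' hM
    (by positivity : 0 < D / g) (by linarith) hm₀ hb0 a i
  set T := (dyadic D).filter (fun d => Nat.gcd b d = g) with hT
  set t₀ := W * M / (b * (D / g)) with ht₀
  have ht₀' : 0 ≤ t₀ := by positivity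
  set μ := min 1 (b * (D / g) / M / 2 ^ i) with hμ
  have hμ0 : 0 ≤ μ := by rw [hμ]; positivity
  set V := Real.sqrt (3 * A ^ 2 * (g.divisors.card : ℝ) ^ (2 * K + 1) * (2 * D / g) *
        W ^ (2 * K + 2 ^ (2 * K + 1))) *
      Real.sqrt (64 * g * (D / g + 4 * 2 ^ i * L / b) * (((b.divisors.card : ℝ) ^ k *
        ((2 * L) ^ (1 / (k : ℝ)) / b) * W ^ 2 ^ k) * (4 * 2 ^ i * W ^ 2))) with hV
  set P : ℕ → ℕ → ℝ → ℝ := fun d ν t =>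
    ‖blockPoly ((dyadic L).filter (fun l => b ∣ l)) a w b i t (ν / (d / g : ℕ))‖ with hP
  have hPc : ∀ d ν, Continuous (P d ν) := fun d ν => (continuous_blockPoly _ _ _ _ _ _).norm
  have hsumc : Continuous fun t => ∑ d ∈ T, ‖α d‖ * ∑ ν ∈ rootsNegOne d, P d ν t :=
    continuous_finsetSum _ fun d _ => continuous_const.mul
      (continuous_finsetSum _ fun ν _ => hPc d ν)
  have h1 : ∑ d ∈ T, ‖α d‖ * ∑ ν ∈ rootsNegOne d, ‖blockSum ψ M L m₀ a b i d ν‖ ≤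
      C₀ * μ * ∫ t in (-t₀)..t₀, ∑ d ∈ T, ‖α d‖ * ∑ ν ∈ rootsNegOne d, P d ν t := by
    have hdc : ∀ d, Continuous fun t => ‖α d‖ * ∑ ν ∈ rootsNegOne d, P d ν t := fun d =>
      continuous_const.mul (continuous_finsetSum _ fun ν _ => hPc d ν)
    rw [intervalIntegral.integral_finsetSum fun d _ => (hdc d).intervalIntegrable _ _, mul_sum]
    refine sum_le_sum fun d hd => ?_
    rw [intervalIntegral.integral_const_mul, intervalIntegral.integral_finsetSum
      fun ν _ => (hPc d ν).intervalIntegrable _ _, mul_left_comm, mul_sum (rootsNegOne d) _ (C₀ * μ)]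
    refine mul_le_mul_of_nonneg_left (sum_le_sum fun ν _ => ?_) (norm_nonneg _)
    rw [hT, mem_filter, mem_dyadic hD.le] at hd
    refine hbd d hd.2 ?_ ?_ ν
    · rw [div_mul_cancel₀ _ hgR.ne']; exact hd.1.1
    · rw [mul_assoc, div_mul_cancel₀ _ hgR.ne']; exact hd.1.2
  have h2 : ∫ t in (-t₀)..t₀, ∑ d ∈ T, ‖α d‖ * ∑ ν ∈ rootsNegOne d, P d ν t ≤ 2 * t₀ * V := by
    calc _ ≤ ∫ _ in (-t₀)..t₀, V :=
          intervalIntegral.integral_mono_on (by linarith) (hsumc.intervalIntegrable _ _)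
            (by simp) fun t _ =>
            sum_norm_blockPoly_le hk hA hD hL hg hb ha hα hWD hWL hWi hw t
      _ = _ := by rw [intervalIntegral.integral_const, smul_eq_mul]; ring
  have hτ : (g.divisors.card : ℝ) ≤ b.divisors.card := by
    exact_mod_cast card_le_card (Nat.divisors_subset_of_dvd hb0.ne' hgb)
  have h3 := block_quantity_le (A := A) (D := D) (L := L) (M := M) (W := W)
    (X := (2 * L) ^ (1 / (k : ℝ))) (b := b) (g := g) (τb := b.divisors.card) (τg := g.divisors.card)
    hD hL hM hbR hgR hW1 (by positivity) hA (one_le_card_divisors hg.ne') hτ K k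
    (2 * K + 2 ^ (2 * K + 1)) (2 ^ k) i
  calc _ ≤ C₀ * μ * (2 * t₀ * V) := h1.trans (mul_le_mul_of_nonneg_left h2 (by positivity))
    _ = C₀ * (μ * (2 * t₀) * V) := by ring
    _ ≤ _ := mul_le_mul_of_nonneg_left h3 hC₀'

/-! ### Truncation error and summation over the blocks. -/

theorem sum_le_of_card_le {ι : Type*} (s : Finset ι) {f : ι → ℝ} {N B : ℝ} (hs : (s.card : ℝ) ≤ N)
    (hB : 0 ≤ B) (hf : ∀ i ∈ s, f i ≤ B) : ∑ i ∈ s, f i ≤ N * B := by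
  refine (sum_le_card_nsmul s f B hf).trans ?_
  rw [nsmul_eq_mul]
  exact mul_le_mul_of_nonneg_right hs hB

theorem card_dyadic_le {N : ℝ} (hN : 0 ≤ N) : ((dyadic N).card : ℝ) ≤ 2 * N := by
  rw [dyadic, Nat.card_Ioc]
  exact (Nat.cast_le.mpr (Nat.sub_le _ _)).trans (Nat.floor_le (by positivity))

/-- The exponent 4K + 12 counts powers of Z: 4K from α, 2 each for the numbers of d, l, ν and b, and
4 for lcm(b, d). -/
theorem truncation_error_le {A C M L D c : ℝ} {K I : ℕ} (hA : 0 < A) (hC : 0 ≤ C) (hc : 0 < c)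
    (hM : c ≤ M) (hL : 0 < L) (hD : 0 < D) {α : ℕ → ℂ} (hα : DivisorBoundedBy A K α)
    (hI : (3 + M + L + D) ^ (2 * (4 * K + 12)) ≤ ((2 ^ I : ℕ) : ℝ)) :
    ∑ d ∈ dyadic D, ‖α d‖ * ∑ l ∈ dyadic L, ∑ _ν ∈ rootsNegOne d, ∑ b ∈ l.divisors,
        C * (((Nat.lcm b d : ℕ) : ℝ) / M) / Real.sqrt ((2 ^ I : ℕ) : ℝ) ≤ A * C / c := by
  set Z := 3 + M + L + D with hZ
  have hM0 : 0 < M := hc.trans_le hM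
  have hZ3 : 3 ≤ Z := by linarith
  have hZ0 : 0 < Z := by linarith
  have hZL : 2 * L ≤ Z ^ 2 := by nlinarith
  have hZD : 2 * D + 2 ≤ Z ^ 2 := by nlinarith
  have hsqrt : Z ^ (4 * K + 12) ≤ Real.sqrt ((2 ^ I : ℕ) : ℝ) := by
    apply Real.le_sqrt_of_sq_le
    rw [← pow_mul, mul_comm _ 2]
    exact hI
  set B := C * (Z ^ 2 * Z ^ 2 / c) / Z ^ (4 * K + 12) with hB
  have hB0 : 0 ≤ B := by positivity
  have hdmem : ∀ d ∈ dyadic D, 1 ≤ d ∧ (d : ℝ) + 2 ≤ Z ^ 2 := by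
    intro d hd
    rw [mem_dyadic hD.le] at hd
    exact ⟨by exact_mod_cast hD.trans hd.1, by linarith⟩
  have hlmem : ∀ l ∈ dyadic L, 1 ≤ l ∧ (l : ℝ) ≤ Z ^ 2 := by
    intro l hl
    rw [mem_dyadic hL.le] at hl
    exact ⟨by exact_mod_cast hL.trans hl.1, by linarith⟩
  have hinner : ∀ d ∈ dyadic D, ∑ l ∈ dyadic L, ∑ _ν ∈ rootsNegOne d, ∑ b ∈ l.divisors,
      C * (((Nat.lcm b d : ℕ) : ℝ) / M) / Real.sqrt ((2 ^ I : ℕ) : ℝ) ≤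
      Z ^ 2 * (Z ^ 2 * (Z ^ 2 * B)) := by
    intro d hd
    obtain ⟨hd1, hdZ⟩ := hdmem d hd
    refine sum_le_of_card_le _ ((card_dyadic_le hL.le).trans hZL) (by positivity) fun l hl => ?_
    obtain ⟨hl1, hlZ⟩ := hlmem l hl
    refine sum_le_of_card_le _ ?_ (by positivity) fun ν _ => ?_
    · have : (rootsNegOne d).card ≤ d := by
        have := card_filter_le (range d) (fun ν => d ∣ ν ^ 2 + 1)
        rwa [card_range] at this
      have : ((rootsNegOne d).card : ℝ) ≤ d := by exact_mod_cast this
      linarith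
    refine sum_le_of_card_le _ ?_ (by positivity) fun b hb => ?_
    · have : (l.divisors.card : ℝ) ≤ l := by exact_mod_cast Nat.card_divisors_le_self l
      linarith
    have hbl : (b : ℝ) ≤ l := by exact_mod_cast Nat.divisor_le hb
    have hlcm : ((Nat.lcm b d : ℕ) : ℝ) ≤ Z ^ 2 * Z ^ 2 := by
      have h1 : Nat.lcm b d ≤ b * d := Nat.le_of_dvd
        (Nat.mul_pos (Nat.pos_of_mem_divisors hb) hd1) (Nat.lcm_dvd_mul b d)
      have h2 : ((Nat.lcm b d : ℕ) : ℝ) ≤ b * d := by exact_mod_cast h1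
      refine h2.trans ?_
      gcongr
      · linarith
      · linarith
    rw [hB]
    gcongr
  have hαd : ∀ d ∈ dyadic D, ‖α d‖ ≤ A * Z ^ (4 * K) := by
    intro d hd
    obtain ⟨hd1, hdZ⟩ := hdmem d hd
    refine (hα d hd1).trans ?_
    have h1 : (d.divisors.card : ℝ) ≤ Z ^ 2 := by
      have : (d.divisors.card : ℝ) ≤ d := by exact_mod_cast Nat.card_divisors_le_self d
      linarith
    have h2 : Real.log ((d : ℝ) + 2) ≤ Z ^ 2 :=
      (Real.log_le_self (by positivity)).trans hdZ
    have h3 : 0 ≤ Real.log ((d : ℝ) + 2) := Real.log_nonneg (by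
      have := Nat.cast_nonneg (α := ℝ) d; linarith)
    calc _ ≤ A * (Z ^ 2) ^ K * (Z ^ 2) ^ K := by gcongr
      _ = _ := by rw [mul_assoc, ← pow_mul, ← pow_add]; congr 2; ring
  have hcardD : ((dyadic D).card : ℝ) ≤ Z ^ 2 := (card_dyadic_le hD.le).trans (by linarith)
  calc _ ≤ Z ^ 2 * (A * Z ^ (4 * K) * (Z ^ 2 * (Z ^ 2 * (Z ^ 2 * B)))) :=
        sum_le_of_card_le _ hcardD (by positivity) fun d hd =>
          mul_le_mul (hαd d hd) (hinner d hd)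
            (sum_nonneg fun _ _ => sum_nonneg fun _ _ => sum_nonneg fun _ _ => by positivity)
            (by positivity)
    _ = A * C / c := by
        rw [hB, pow_add]
        field_simp

theorem exists_sup_bounds {ψ : ℝ → ℂ} (hψ : ContDiff ℝ 1 ψ) (hψc : HasCompactSupport ψ) :
    ∃ C₀ R : ℝ, 0 ≤ R ∧ (∀ x, ‖ψ x‖ ≤ C₀) ∧ (∀ x, ‖deriv ψ x‖ ≤ C₀) ∧
      (∀ x, R < |x| → ψ x = 0) ∧ ∀ x, R < |x| → deriv ψ x = 0 := by
  obtain ⟨C₁, hC₁⟩ := hψc.exists_bound_of_continuous hψ.continuous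
  obtain ⟨C₂, hC₂⟩ := hψc.deriv.exists_bound_of_continuous (hψ.continuous_deriv le_rfl)
  obtain ⟨R, hR⟩ := hψc.isCompact.isBounded.subset_closedBall 0
  have hout : ∀ x, max R 0 < |x| → x ∉ tsupport ψ := by
    intro x hx hmem
    have := hR hmem
    rw [mem_closedBall_zero_iff, Real.norm_eq_abs] at this
    exact absurd (this.trans (le_max_left R 0)) (not_le.mpr hx)
  refine ⟨max C₁ C₂, max R 0, le_max_right _ _, fun x => (hC₁ x).trans (le_max_left _ _),
    fun x => (hC₂ x).trans (le_max_right _ _), fun x hx => image_eq_zero_of_notMem_tsupport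
      (hout x hx), fun x hx => ?_⟩
  by_contra h
  exact hout x hx (support_deriv_subset (Function.mem_support.mpr h))

theorem typeIError_bound {k : ℕ} (hk : 1 ≤ k) {ψ : ℝ → ℂ} (hψ : ContDiff ℝ 2 ψ)
    (hψc : HasCompactSupport ψ) {c A : ℝ} (K : ℕ) (hc : 0 < c) (hA : 0 < A) :
    ∃ (C : ℝ) (B : ℕ), 0 ≤ C ∧ ∀ (M L D m₀ : ℝ) (a α : ℕ → ℂ), c ≤ M → c ≤ L → c ≤ D →
      SupportedOnPowers k a → DivisorBoundedBy A K α → |m₀| ≤ A * M * logFactor M L D ^ K →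
      ‖typeIError ψ M L D m₀ a α‖ ≤ C * logFactor M L D ^ B *
        ((L + M) ^ (1 / 2 : ℝ) * D ^ (1 / 2 : ℝ) * L ^ (1 / (2 * (k : ℝ)))) := by
  have hψ1 : ContDiff ℝ 1 ψ := hψ.of_le (by norm_num)
  obtain ⟨C₀, R, hR0, hC₀, hC₁, hR, hR'⟩ := exists_sup_bounds hψ1 hψc
  obtain ⟨Cp, hCp, hP⟩ := exists_poisson_truncation hψ hψc
  have hC₀' : 0 ≤ C₀ := (norm_nonneg _).trans (hC₀ 0)
  have hkR : (0 : ℝ) < k := by exact_mod_cast hk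
  set E : ℕ := 4 * K + 12 with hE
  set F : ℕ := 2 * K + 1 + k with hF
  set n : ℕ := 4 + (2 * K + 2 ^ (2 * K + 1)) + 2 ^ k with hn
  set V : ℝ := 4 * E + 4 + A + R with hV
  have hV0 : 0 ≤ V := by positivity
  -- A lower bound for the target quantity when M, L, D ≥ c; it absorbs the bounded truncation
  -- error.
  set y₀ : ℝ := (c + c) ^ (1 / 2 : ℝ) * c ^ (1 / 2 : ℝ) * c ^ (1 / (2 * (k : ℝ))) with hy₀
  have hy₀' : 0 < y₀ := by positivity
  refine ⟨C₀ * 157 * A * 2 * V ^ (n + (1 + 2 ^ (F + 1))) + A * Cp / c / y₀,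
    (K + 1) * (n + (1 + 2 ^ (F + 1))), by positivity, ?_⟩
  intro M L D m₀ a α hM hL hD ha hα hm₀
  have hM0 : 0 < M := hc.trans_le hM
  have hL0 : 0 < L := hc.trans_le hL
  have hD0 : 0 < D := hc.trans_le hD
  set Z := 3 + M + L + D with hZ
  set ℓ := logFactor M L D with hℓ
  have hℓZ : ℓ = Real.log Z := rfl
  have hZ3 : 3 ≤ Z := by linarith
  have hZ0 : 0 < Z := by linarith
  have hℓ1 : 1 ≤ ℓ := by
    rw [hℓZ, Real.le_log_iff_exp_le hZ0]
    exact Real.exp_one_lt_three.le.trans hZ3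
  have hpow : ℓ ≤ ℓ ^ (K + 1) := le_self_pow₀ hℓ1 (by omega)
  have hpow' : 1 ≤ ℓ ^ (K + 1) := one_le_pow₀ hℓ1
  -- A single majorant for every logarithm, for the number of blocks and for (|m₀| + RM)/M. The
  -- power K + 1 covers both ℓ^K from m₀ and the single ℓ from the others.
  set W := V * ℓ ^ (K + 1) with hW
  have hVW : ∀ x : ℝ, x ≤ V * ℓ → x ≤ W := fun x hx =>
    hx.trans (mul_le_mul_of_nonneg_left hpow hV0)
  have hlogZ2 : Real.log (Z ^ 2) = 2 * ℓ := by rw [Real.log_pow, hℓZ]; norm_num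
  have hEr : (0 : ℝ) ≤ E := Nat.cast_nonneg _
  have hEℓ : 0 ≤ E * ℓ := by positivity
  have hVℓ : 4 * (E * ℓ) + 4 * ℓ ≤ V * ℓ := by
    have h1 : 4 * E + 4 ≤ V := by linarith
    have h2 := mul_le_mul_of_nonneg_right h1 (zero_le_one.trans hℓ1)
    linarith
  have hZZ : 3 * Z ≤ Z ^ 2 := by
    have := mul_le_mul_of_nonneg_right hZ3 hZ0.le
    linarith [sq Z]
  have hWL : 1 + Real.log (2 * L + 2) ≤ W := by
    apply hVW
    have : Real.log (2 * L + 2) ≤ 2 * ℓ := by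
      rw [← hlogZ2]; exact Real.log_le_log (by linarith) (by linarith)
    linarith
  have hWD : 1 + Real.log (2 * D + 2) ≤ W := by
    apply hVW
    have : Real.log (2 * D + 2) ≤ 2 * ℓ := by
      rw [← hlogZ2]; exact Real.log_le_log (by linarith) (by linarith)
    linarith
  have hW1 : 1 ≤ W := by
    have := Real.log_nonneg (by linarith : 1 ≤ 2 * D + 2)
    linarith
  -- the number of blocks
  set I : ℕ := ⌈2 * E * ℓ / Real.log 2⌉₊ with hI
  have hlog2 : 0 < Real.log 2 := Real.log_pos one_lt_two
  have hIlow : Z ^ (2 * E) ≤ ((2 ^ I : ℕ) : ℝ) := by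
    have h1 : 2 * E * ℓ / Real.log 2 ≤ I := Nat.le_ceil _
    rw [div_le_iff₀ hlog2] at h1
    push_cast
    rw [← Real.log_le_log_iff (by positivity) (by positivity), Real.log_pow, Real.log_pow, ← hℓZ]
    push_cast
    exact h1
  have hIup : (I : ℝ) ≤ 4 * E * ℓ + 1 := by
    have h1 : (I : ℝ) < 2 * E * ℓ / Real.log 2 + 1 := Nat.ceil_lt_add_one (by positivity)
    have h2 : 2 * E * ℓ / Real.log 2 ≤ 4 * E * ℓ := by
      rw [div_le_iff₀ hlog2]
      have h3 : (1 : ℝ) / 2 ≤ Real.log 2 := by linarith [Real.log_two_gt_d9]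
      have h4 := mul_le_mul_of_nonneg_left h3 hEℓ
      linarith
    linarith
  have hIW : 1 + (I : ℝ) ≤ W := by
    apply hVW
    linarith
  have hWi : ∀ i ∈ range I, 1 + Real.log ((2 ^ (i + 1) : ℕ) : ℝ) ≤ W := by
    intro i hi
    refine le_trans ?_ hIW
    have h1 : ((i + 1 : ℕ) : ℝ) ≤ I := by exact_mod_cast mem_range.mp hi
    have h2 : Real.log 2 ≤ 1 := by linarith [Real.log_two_lt_d9]
    rw [Nat.cast_pow, Real.log_pow]
    push_cast at h1 ⊢
    have h3 : ((i : ℝ) + 1) * Real.log 2 ≤ ((i : ℝ) + 1) * 1 := by gcongr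
    linarith
  have hm₀' : |m₀| + R * M ≤ W * M := by
    have h1 : ℓ ^ K ≤ ℓ ^ (K + 1) := pow_le_pow_right₀ hℓ1 (Nat.le_succ K)
    have h2 : A * M * ℓ ^ K ≤ A * M * ℓ ^ (K + 1) := by gcongr
    have h3 : R * M ≤ R * M * ℓ ^ (K + 1) := le_mul_of_one_le_right (by positivity) hpow'
    have h4 : 0 ≤ (4 * E + 4) * M * ℓ ^ (K + 1) := by positivity
    have h5 : |m₀| + R * M ≤ A * M * ℓ ^ (K + 1) + R * M * ℓ ^ (K + 1) :=
      add_le_add (hm₀.trans h2) h3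
    rw [hW, hV]
    linarith
  have ha1 : ∀ l, ‖a l‖ ≤ 1 := fun l => (ha l).trans
    (Set.indicator_le_self' (fun _ _ => zero_le_one) l)
  set Y := Real.sqrt (D * (M + L) * (2 * L) ^ (1 / (k : ℝ))) with hY
  set y := (L + M) ^ (1 / 2 : ℝ) * D ^ (1 / 2 : ℝ) * L ^ (1 / (2 * (k : ℝ))) with hy
  have hYy : Y ≤ 2 * y := by
    have h1 : (2 : ℝ) ^ (1 / (2 * (k : ℝ))) ≤ 2 := by
      calc (2 : ℝ) ^ (1 / (2 * (k : ℝ))) ≤ 2 ^ (1 : ℝ) := by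
            apply Real.rpow_le_rpow_of_exponent_le one_le_two
            rw [div_le_one (by positivity)]
            have : (1 : ℝ) ≤ k := by exact_mod_cast hk
            linarith
        _ = 2 := Real.rpow_one _
    have h2 : Y = D ^ (1 / 2 : ℝ) * (M + L) ^ (1 / 2 : ℝ) *
        ((2 : ℝ) ^ (1 / (2 * (k : ℝ))) * L ^ (1 / (2 * (k : ℝ)))) := by
      rw [hY, Real.sqrt_eq_rpow, Real.mul_rpow (by positivity) (by positivity),
        Real.mul_rpow (by positivity) (by positivity), ← Real.rpow_mul (by positivity)]
      have h3 : 1 / (k : ℝ) * (1 / 2) = 1 / (2 * (k : ℝ)) := by field_simp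
      rw [h3, Real.mul_rpow zero_le_two hL0.le]
    rw [h2, hy, add_comm M L]
    calc _ = (2 : ℝ) ^ (1 / (2 * (k : ℝ))) *
          ((L + M) ^ (1 / 2 : ℝ) * D ^ (1 / 2 : ℝ) * L ^ (1 / (2 * (k : ℝ)))) := by ring
      _ ≤ _ := by gcongr
  have hyy : y₀ ≤ y := by
    rw [hy₀, hy]; gcongr
  have hmain : (∑ b ∈ (Icc 1 ⌊2 * L⌋₊).filter Squarefree, ∑ i ∈ range I, ∑ g ∈ b.divisors,
        ∑ d ∈ (dyadic D).filter (fun d => Nat.gcd b d = g), ‖α d‖ * ∑ ν ∈ rootsNegOne d,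
        ‖blockSum ψ M L m₀ a b i d ν‖) ≤ C₀ * 157 * A * W ^ (n + (1 + 2 ^ (F + 1))) * Y := by
    -- Summing over the blocks costs one more W, and over g ∣ b one more τ(b), since the bound for a
    -- block depends on neither i nor g.
    have h1 : ∀ b ∈ (Icc 1 ⌊2 * L⌋₊).filter Squarefree, (∑ i ∈ range I, ∑ g ∈ b.divisors,
        ∑ d ∈ (dyadic D).filter (fun d => Nat.gcd b d = g), ‖α d‖ * ∑ ν ∈ rootsNegOne d,
        ‖blockSum ψ M L m₀ a b i d ν‖) ≤
        C₀ * 157 * A * W ^ (n + 1) * Y * ((b.divisors.card : ℝ) ^ (F + 1) / b) := by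
      intro b hb
      have hbsq := (mem_filter.mp hb).2
      have hB0 : 0 ≤ C₀ * (157 * A * W ^ n * ((b.divisors.card : ℝ) ^ F / b) * Y) := by positivity
      have h2 := sum_le_of_card_le (range I) (N := W) (f := fun i => ∑ g ∈ b.divisors,
        ∑ d ∈ (dyadic D).filter (fun d => Nat.gcd b d = g), ‖α d‖ * ∑ ν ∈ rootsNegOne d,
        ‖blockSum ψ M L m₀ a b i d ν‖) (by rw [card_range]; linarith)
        (mul_nonneg (Nat.cast_nonneg b.divisors.card) hB0) fun i hi =>
          sum_le_of_card_le _ le_rfl hB0 fun g hg =>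
            block_bound hψ1 hψc hC₀ hC₁ hR hR' hk hA hM0 hD0 hL0 hbsq
              (Nat.dvd_of_mem_divisors hg) ha hα hm₀' hWD hWL (hWi i hi)
      refine h2.trans (le_of_eq ?_)
      rw [pow_succ _ n, pow_succ _ F]
      ring
    have h3 : ∑ b ∈ (Icc 1 ⌊2 * L⌋₊).filter Squarefree, (b.divisors.card : ℝ) ^ (F + 1) / b ≤
        W ^ 2 ^ (F + 1) := by
      refine (sum_le_sum_of_subset_of_nonneg (filter_subset _ _)
        fun _ _ _ => by positivity).trans ((sum_card_divisors_pow_div_le _ _).trans ?_)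
      have h5 := Real.log_natCast_nonneg ⌊2 * L⌋₊
      have h6 : Real.log (⌊2 * L⌋₊ : ℕ) ≤ Real.log (2 * L + 2) := by
        rcases Nat.eq_zero_or_pos ⌊2 * L⌋₊ with h | h
        · rw [h]; simp; exact Real.log_nonneg (by linarith)
        · exact Real.log_le_log (by exact_mod_cast h)
            ((Nat.floor_le (by positivity)).trans (by linarith))
      gcongr
      linarith
    refine (sum_le_sum h1).trans ?_
    rw [← mul_sum]
    calc _ ≤ C₀ * 157 * A * W ^ (n + 1) * Y * W ^ 2 ^ (F + 1) :=
          mul_le_mul_of_nonneg_left h3 (by positivity)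
      _ = _ := by rw [← add_assoc n, pow_add W (n + 1)]; ring
  have htail := truncation_error_le hA hCp hc hM hL0 hD0 hα hIlow
  have hdecomp := norm_typeIError_le hψc hP hM0 L D m₀ ha1 α I
  have hℓB : 1 ≤ ℓ ^ ((K + 1) * (n + (1 + 2 ^ (F + 1)))) := one_le_pow₀ hℓ1
  have hy0 : 0 ≤ y := hy₀'.le.trans hyy
  calc ‖typeIError ψ M L D m₀ a α‖ ≤
        C₀ * 157 * A * W ^ (n + (1 + 2 ^ (F + 1))) * Y + A * Cp / c :=
        hdecomp.trans (add_le_add hmain htail)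
    _ ≤ C₀ * 157 * A * W ^ (n + (1 + 2 ^ (F + 1))) * (2 * y) + A * Cp / c / y₀ * y := by
        refine add_le_add (mul_le_mul_of_nonneg_left hYy (by positivity)) ?_
        rw [div_mul_eq_mul_div, le_div_iff₀ hy₀']
        exact mul_le_mul_of_nonneg_left hyy (by positivity)
    _ ≤ C₀ * 157 * A * W ^ (n + (1 + 2 ^ (F + 1))) * (2 * y) +
        A * Cp / c / y₀ * (ℓ ^ ((K + 1) * (n + (1 + 2 ^ (F + 1)))) * y) := by
        gcongr
        exact le_mul_of_one_le_left hy0 hℓB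
    _ = _ := by
        rw [hW, mul_pow V, ← pow_mul]
        ring

/-! ### From logarithms to powers of x, and the conclusion. -/

theorem log_pow_le_rpow {V x ε : ℝ} (hV : 0 < V) (hx : 1 ≤ x) (hε : 0 < ε) (B : ℕ) {y : ℝ}
    (hy : 1 ≤ y) (hyx : y ≤ V * x) :
    Real.log y ^ B ≤ (V ^ (ε / (B + 1)) / (ε / (B + 1))) ^ B * x ^ ε := by
  have hx0 : 0 < x := by linarith
  -- Dividing by B + 1 rather than B keeps δB ≤ ε and also covers B = 0.
  set δ := ε / (B + 1) with hδ
  have hδ0 : 0 < δ := by positivity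
  have h1 : Real.log y ≤ V ^ δ / δ * x ^ δ := by
    calc Real.log y ≤ Real.log (V * x) := Real.log_le_log (by linarith) hyx
      _ ≤ (V * x) ^ δ / δ := Real.log_le_rpow_div (by positivity) hδ0
      _ = _ := by rw [Real.mul_rpow hV.le hx0.le]; ring
  have h0 : 0 ≤ Real.log y := Real.log_nonneg hy
  calc Real.log y ^ B ≤ (V ^ δ / δ * x ^ δ) ^ B := by gcongr
    _ = (V ^ δ / δ) ^ B * x ^ (δ * B) := by
        rw [mul_pow, ← Real.rpow_natCast (x ^ δ), ← Real.rpow_mul hx0.le]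
    _ ≤ _ := by
        gcongr
        rw [hδ, div_mul_eq_mul_div, div_le_iff₀ (by positivity)]
        linarith

end TypeI

end

theorem proposition3 (k : ℕ) (hk : 1 ≤ k) (ψ : ℝ → ℂ) (hψ : ContDiff ℝ ∞ ψ)
    (hψc : HasCompactSupport ψ) (c A ε : ℝ) (K : ℕ) (hc : 0 < c) (hA : 0 < A) (hε : 0 < ε) :
    (∃ (C : ℝ) (B : ℕ), ∀ (M L D m₀ : ℝ) (a α : ℕ → ℂ),
      c ≤ M → c ≤ L → c ≤ D →
      TypeI.SupportedOnPowers k a → TypeI.DivisorBoundedBy A K α →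
      |m₀| ≤ A * M * TypeI.logFactor M L D ^ K →
      ‖TypeI.typeIError ψ M L D m₀ a α‖ ≤
        C * TypeI.logFactor M L D ^ B *
          (M ^ ε * (L + M) ^ (1 / 2 : ℝ) * D ^ (1 / 2 : ℝ) * L ^ (1 / (2 * (k : ℝ))))) ∧
    (∃ C : ℝ, ∀ (x M L D m₀ : ℝ) (a α : ℕ → ℂ),
      1 ≤ x → c ≤ M → M ≤ A * x ^ (1 / 2 : ℝ) → c ≤ L → L ≤ A * x ^ (1 / 2 : ℝ) →
      c ≤ D → D ≤ x ^ (1 / 2 + 1 / (2 * (k : ℝ)) - ε) →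
      TypeI.SupportedOnPowers k a → TypeI.DivisorBoundedBy A K α →
      |m₀| ≤ A * M * TypeI.logFactor M L D ^ K →
      ‖TypeI.typeIError ψ M L D m₀ a α‖ ≤ C * x ^ (1 / 2 + 1 / (2 * (k : ℝ)) - ε / 4)) := by
  obtain ⟨C, B, hC, hbd⟩ :=
    TypeI.typeIError_bound hk (contDiff_infty.mp hψ 2) hψc K hc hA
  have hkR : (1 : ℝ) ≤ k := by exact_mod_cast hk
  constructor
  -- The bound already holds without M^ε; since M^ε ≥ c^ε, inserting it only changes the constant.
  · refine ⟨C / c ^ ε, B, fun M L D m₀ a α hM hL hD ha hα hm => ?_⟩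
    have hM0 : 0 < M := hc.trans_le hM
    have hL0 : 0 < L := hc.trans_le hL
    have hD0 : 0 < D := hc.trans_le hD
    have hlog : 0 ≤ TypeI.logFactor M L D := Real.log_nonneg (by linarith)
    have hcε : 0 < c ^ ε := Real.rpow_pos_of_pos hc ε
    have hMε : c ^ ε ≤ M ^ ε := Real.rpow_le_rpow hc.le hM hε.le
    set y := (L + M) ^ (1 / 2 : ℝ) * D ^ (1 / 2 : ℝ) * L ^ (1 / (2 * (k : ℝ))) with hy
    calc _ ≤ C * TypeI.logFactor M L D ^ B * y := hbd M L D m₀ a α hM hL hD ha hα hm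
      _ = C / c ^ ε * TypeI.logFactor M L D ^ B * (c ^ ε * y) := by field_simp
      _ ≤ C / c ^ ε * TypeI.logFactor M L D ^ B * (M ^ ε * y) := by gcongr
      _ = _ := by rw [hy]; ring
  -- Since M, L ≤ Ax and D ≤ x, the argument 3 + M + L + D of the logarithm is at most (4 + 2A)x.
  · set Q := (4 + 2 * A) with hQ
    set G := (Q ^ (ε / 4 / (B + 1)) / (ε / 4 / (B + 1))) ^ B with hG
    refine ⟨C * G * ((2 * A) ^ (1 / 2 : ℝ) * A ^ (1 / (2 * (k : ℝ)))),
      fun x M L D m₀ a α hx hM hMx hL hLx hD hDx ha hα hm => ?_⟩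
    have hx0 : 0 < x := by linarith
    have hM0 : 0 < M := hc.trans_le hM
    have hL0 : 0 < L := hc.trans_le hL
    have hD0 : 0 < D := hc.trans_le hD
    have hk2 : 1 / (2 * (k : ℝ)) ≤ 1 / 2 := by gcongr; linarith
    have hxs : x ^ (1 / 2 : ℝ) ≤ x := by
      calc x ^ (1 / 2 : ℝ) ≤ x ^ (1 : ℝ) :=
            Real.rpow_le_rpow_of_exponent_le hx (by norm_num)
        _ = x := Real.rpow_one x
    have hDx1 : D ≤ x := by
      refine hDx.trans ?_
      calc _ ≤ x ^ (1 : ℝ) := Real.rpow_le_rpow_of_exponent_le hx (by linarith)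
        _ = x := Real.rpow_one x
    have hAx := mul_le_mul_of_nonneg_left hxs hA.le
    have hlog : TypeI.logFactor M L D ^ B ≤ G * x ^ (ε / 4) :=
      TypeI.log_pow_le_rpow (by positivity) hx (by positivity) B (by linarith) (by
        rw [hQ]; linarith)
    have hlog0 : 0 ≤ TypeI.logFactor M L D := Real.log_nonneg (by linarith)
    have hG0 : 0 ≤ G := by positivity
    have h1 : (L + M) ^ (1 / 2 : ℝ) ≤ (2 * A) ^ (1 / 2 : ℝ) * x ^ (1 / 4 : ℝ) := by
      calc (L + M) ^ (1 / 2 : ℝ) ≤ (2 * A * x ^ (1 / 2 : ℝ)) ^ (1 / 2 : ℝ) := by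
            gcongr; linarith
        _ = _ := by
            rw [Real.mul_rpow (by positivity) (by positivity), ← Real.rpow_mul hx0.le]
            norm_num
    have h2 : D ^ (1 / 2 : ℝ) ≤ x ^ ((1 / 2 + 1 / (2 * (k : ℝ)) - ε) * (1 / 2)) := by
      rw [Real.rpow_mul hx0.le]
      gcongr
    have h3 : L ^ (1 / (2 * (k : ℝ))) ≤ A ^ (1 / (2 * (k : ℝ))) *
        x ^ (1 / 2 * (1 / (2 * (k : ℝ)))) := by
      calc L ^ (1 / (2 * (k : ℝ))) ≤ (A * x ^ (1 / 2 : ℝ)) ^ (1 / (2 * (k : ℝ))) := by gcongr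
        _ = _ := by
            rw [Real.mul_rpow hA.le (by positivity), ← Real.rpow_mul hx0.le]
    calc _ ≤ C * TypeI.logFactor M L D ^ B *
          ((L + M) ^ (1 / 2 : ℝ) * D ^ (1 / 2 : ℝ) * L ^ (1 / (2 * (k : ℝ)))) :=
          hbd M L D m₀ a α hM hL hD ha hα hm
      _ ≤ C * (G * x ^ (ε / 4)) * ((2 * A) ^ (1 / 2 : ℝ) * x ^ (1 / 4 : ℝ) *
          x ^ ((1 / 2 + 1 / (2 * (k : ℝ)) - ε) * (1 / 2)) *
          (A ^ (1 / (2 * (k : ℝ))) * x ^ (1 / 2 * (1 / (2 * (k : ℝ)))))) := by gcongr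
      _ = C * G * ((2 * A) ^ (1 / 2 : ℝ) * A ^ (1 / (2 * (k : ℝ)))) *
          (x ^ (ε / 4) * x ^ (1 / 4 : ℝ) * x ^ ((1 / 2 + 1 / (2 * (k : ℝ)) - ε) * (1 / 2)) *
            x ^ (1 / 2 * (1 / (2 * (k : ℝ))))) := by ring
      -- The exponents add up: ε/4 + 1/4 + (1/4 + 1/(4k) − ε/2) + 1/(4k) = 1/2 + 1/(2k) − ε/4.
      _ = _ := by
          rw [← Real.rpow_add hx0, ← Real.rpow_add hx0, ← Real.rpow_add hx0]
          congr 2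
          ring
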